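/- Let $d\ge 1$ and let $\Omega=\prod_{k=1}^d(a_k,b_k)\subset\mathbb{R}^d$ be a bounded open box (an interval if $d=1$, an axis-aligned rectangle if $d=2$). A partition of $\Omega$ consists of finitely many pairwise disjoint nonempty open axis-aligned boxes $\Omega_1,\dots,\Omega_I\subset\Omega$ with $\overline\Omega=\bigcup_i\overline{\Omega_i}$; its set of interior interfaces is $\Gamma=\Omega\cap\bigcup_{i\ne j}(\partial\Omega_i\cap\partial\Omega_j)$, equipped with the $(d-1)$-dimensional surface measure $dS$ (counting measure if $d=1$, length if $d=2$). Let $p$ be piecewise constant, $p=p_i\in(0,\infty)$ on $\Omega_i$, and $\min p=\min_i p_i$. Let $H^1_0(\Omega)$ be the closure of $C_c^\infty(\Omega)$ in $H^1(\Omega)$, with $\|u\|_{H^1_0}=\|\nabla u\|_{L^2(\Omega)}$. For a field $\sigma$ with $\sigma|_{\Omega_i}\in H(\mathrm{div},\Omega_i)$ for all $i$, let $\operatorname{div}\sigma\in L^2(\Omega)$ denote the piecewise weak divergence, and write $[\sigma\cdot\mathbf n]=g\in L^2(\Gamma)$ if the sum over the subdomains of the outward normal traces of $\sigma$ is represented by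 $g$: $$\sum_i\int_{\Omega_i}\big(\sigma\cdot\nabla\varphi+(\operatorname{div}\sigma)\,\varphi\big)\,dx=\int_\Gamma g\,\varphi\,dS\qquad\text{for all }\varphi\in C_c^\infty(\Omega).$$ Let $$\mathbb X^p=\{u\in H^1_0(\Omega):\ (p\nabla u)|_{\Omega_i}\in H(\mathrm{div},\Omega_i)\text{ for all }i,\ [p\nabla u\cdot\mathbf n]\in L^2(\Gamma)\},$$ and, for $\Theta>0$ and $u\in\mathbb X^p$, $$\|u\|_{\mathbb X^p}=\Big(\|\operatorname{div}(p\nabla u)\|_{L^2(\Omega)}^2+\Theta\,\|[p\nabla u\cdot\mathbf n]\|_{L^2(\Gamma)}^2\Big)^{1/2},$$ $$\|u\|_g=\Big(\|u\|_{H^1_0}^2+\sum_i\|\operatorname{div}(p\nabla u)\|_{L^2(\Omega_i)}^2+\|[p\nabla u\cdot\mathbf n]\|_{L^2(\Gamma)}^2\Big)^{1/2}.$$ Theorem. Fix $\Omega$. For every $\Theta>0$ and every interface set $\Gamma$ there is a constant $C>0$, depending only on $\Omega$, $\Theta$ and $\Gamma$, such that for every partition of $\Omega$ with interface set $\Gamma$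 and every $p$ as above: 1. For all $u\in\mathbb X^p$, $$\|u\|_{H^1_0}\le\frac{C}{\min p}\sqrt{\|\operatorname{div}(p\nabla u)\|_{L^2(\Omega)}^2+\Theta\,\|[p\nabla u\cdot\mathbf n]\|_{L^2(\Gamma)}^2}.$$ 2. $\|\cdot\|_{\mathbb X^p}$ and $\|\cdot\|_g$ are norms on $\mathbb X^p$, and they are equivalent: there are $c_1,c_2>0$ (which may depend on $p$, the partition and $\Theta$) with $c_1\|u\|_g\le\|u\|_{\mathbb X^p}\le c_2\|u\|_g$ for all $u\in\mathbb X^p$. 3. If $\ell\in L^2(\Omega)$ and $\mathfrak u\in H^1_0(\Omega)$ satisfies $\int_\Omega p\nabla\mathfrak u\cdot\nabla v\,dx=\int_\Omega\ell v\,dx$ for all $v\in H^1_0(\Omega)$, then $\mathfrak u\in\mathbb X^p$ and, for all $u\in\mathbb X^p$, $$\|u-\mathfrak u\|_{H^1_0}\le\frac{C}{\min p}\,\|u-\mathfrak u\|_{\mathbb X^p},\qquad \|u-\mathfrak u\|_{\mathbb X^p}=\sqrt{\|\operatorname{div}(p\nabla u)+\ell\|_{L^2(\Omega)}^2+\Theta\,\|[p\nabla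 u\cdot\mathbf n]\|_{L^2(\Gamma)}^2}.$$ -/

import Mathlib

open MeasureTheory Filter Topology TopologicalSpace
open scoped ENNReal ContDiff Distributions InnerProductSpace

namespace Transmission

noncomputable section

/-! ### Test functions, weak gradient, `H¹₀` -/

/-- The Euclidean space `ℝᵈ`. -/
abbrev Space (d : ℕ) := EuclideanSpace ℝ (Fin d)

/-- `L²(U)`. -/
abbrev L2 {d : ℕ} (U : Opens (Space d)) := Lp ℝ 2 (volume.restrict (U : Set (Space d)))

/-- `L²(U)ᵈ`. -/
abbrev L2Vec {d : ℕ} (U : Opens (Space d)) := Lp (Space d) 2 (volume.restrict (U : Set (Space d)))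

/-- `G` is the weak gradient of `u` on `U`:
`∫_U u ∂ₖφ = -∫_U Gₖ φ` for all `φ ∈ C_c^∞(U)` and all `k`. -/
def IsWeakGrad {d : ℕ} (U : Opens (Space d)) (u : L2 U) (G : L2Vec U) : Prop :=
  ∀ φ : 𝓓(U, ℝ), ∀ k : Fin d,
    ∫ x in (U : Set (Space d)), u x * (gradient φ x) k =
      -∫ x in (U : Set (Space d)), (G x) k * φ x

open Classical in
/-- The weak gradient `∇u ∈ L²(U)ᵈ` (it is unique; the value is `0` if there is none). -/
def weakGrad {d : ℕ} (U : Opens (Space d)) (u : L2 U) : L2Vec U :=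
  if h : ∃ G, IsWeakGrad U u G then h.choose else 0

/-- `σ : ℝᵈ → ℝᵈ` has weak divergence `f` on `U`:
`∫_U σ · ∇φ = -∫_U f φ` for all `φ ∈ C_c^∞(U)`. -/
def IsWeakDiv {d : ℕ} (U : Opens (Space d)) (σ : Space d → Space d) (f : L2 U) : Prop :=
  ∀ φ : 𝓓(U, ℝ),
    ∫ x in (U : Set (Space d)), inner ℝ (σ x) (gradient φ x) =
      -∫ x in (U : Set (Space d)), f x * φ x

/-- `σ|_U ∈ H(div, U)`. -/
def MemHdiv {d : ℕ} (U : Opens (Space d)) (σ : Space d → Space d) : Prop :=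
  MemLp σ 2 (volume.restrict (U : Set (Space d))) ∧ ∃ f : L2 U, IsWeakDiv U σ f

open Classical in
/-- The weak divergence `div σ ∈ L²(U)` (it is unique; the value is `0` if there is none). -/
def weakDiv {d : ℕ} (U : Opens (Space d)) (σ : Space d → Space d) : L2 U :=
  if h : ∃ f, IsWeakDiv U σ f then h.choose else 0

/-- The normal trace `σ · n` on `∂U` of a field `σ ∈ H(div, U)`, `n` being the outward unit normal,
as a functional of `φ`: `⟨σ · n, φ⟩_{∂U} = ∫_U (σ · ∇φ + (div σ) φ)`. -/
def normalTrace {d : ℕ} (U : Opens (Space d)) (σ : Space d → Space d) (φ : Space d → ℝ) : ℝ :=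
  ∫ x in (U : Set (Space d)), (inner ℝ (σ x) (gradient φ x) + weakDiv U σ x * φ x)

section Helpers

variable {d : ℕ} {U : Opens (Space d)}

lemma continuous_gradient (φ : 𝓓(U, ℝ)) : Continuous (gradient (φ : Space d → ℝ)) := by
  have h : Continuous (fderiv ℝ (φ : Space d → ℝ)) :=
    φ.contDiff.continuous_fderiv (by simp)
  exact (InnerProductSpace.toDual ℝ (Space d)).symm.continuous.comp h

lemma hasCompactSupport_gradient (φ : 𝓓(U, ℝ)) :
    HasCompactSupport (gradient (φ : Space d → ℝ)) := by
  have h : HasCompactSupport (fderiv ℝ (φ : Space d → ℝ)) := φ.hasCompactSupport.fderiv ℝ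
  exact h.comp_left (g := (InnerProductSpace.toDual ℝ (Space d)).symm) (map_zero _)

lemma differentiable_test (φ : 𝓓(U, ℝ)) : Differentiable ℝ (φ : Space d → ℝ) :=
  φ.contDiff.differentiable (by simp)

lemma memLp_test (φ : 𝓓(U, ℝ)) (μ : Measure (Space d)) [IsFiniteMeasureOnCompacts μ] :
    MemLp (φ : Space d → ℝ) 2 μ :=
  φ.continuous.memLp_of_hasCompactSupport φ.hasCompactSupport

lemma memLp_gradient (φ : 𝓓(U, ℝ)) (μ : Measure (Space d)) [IsFiniteMeasureOnCompacts μ] :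
    MemLp (gradient (φ : Space d → ℝ)) 2 μ :=
  (continuous_gradient φ).memLp_of_hasCompactSupport (hasCompactSupport_gradient φ)

lemma gradient_add_test (φ ψ : 𝓓(U, ℝ)) (x : Space d) :
    gradient (φ + ψ : 𝓓(U, ℝ)) x = gradient φ x + gradient ψ x := by
  have : ((φ + ψ : 𝓓(U, ℝ)) : Space d → ℝ) = (φ : Space d → ℝ) + ψ := by
    ext; simp
  rw [gradient, this, fderiv_add (differentiable_test φ x) (differentiable_test ψ x), map_add]
  rfl

lemma gradient_smul_test (c : ℝ) (φ : 𝓓(U, ℝ)) (x : Space d) :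
    gradient (c • φ : 𝓓(U, ℝ)) x = c • gradient φ x := by
  have : ((c • φ : 𝓓(U, ℝ)) : Space d → ℝ) = c • (φ : Space d → ℝ) := by
    ext; simp
  rw [gradient, this, fderiv_const_smul (differentiable_test φ x)]
  simp [gradient]

/-- Fundamental lemma of the calculus of variations. -/
lemma eq_zero_of_forall_test (h : L2 U)
    (H : ∀ φ : 𝓓(U, ℝ), ∫ x in (U : Set (Space d)), h x * φ x = 0) : h = 0 := by
  have hloc : LocallyIntegrableOn h (U : Set (Space d)) volume := by
    have h1 : LocallyIntegrable h (volume.restrict (U : Set (Space d))) :=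
      (Lp.memLp h).locallyIntegrable (by norm_num)
    exact locallyIntegrableOn_of_locallyIntegrable_restrict h1
  have key := U.isOpen.ae_eq_zero_of_integral_contDiff_smul_eq_zero hloc (by
    intro g hg hc hs
    have := H ⟨g, hg, hc, hs⟩
    rw [← setIntegral_eq_integral_of_forall_compl_eq_zero (s := (U : Set (Space d)))
      (fun x hx => by
        rw [image_eq_zero_of_notMem_tsupport (fun h => hx (hs h)), zero_smul])]
    simpa [mul_comm] using this)
  rw [Lp.eq_zero_iff_ae_eq_zero, EventuallyEq, ae_restrict_iff' U.isOpen.measurableSet]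
  exact key

lemma integrable_mul {μ : Measure (Space d)} {f g : Space d → ℝ} (hf : MemLp f 2 μ)
    (hg : MemLp g 2 μ) : Integrable (fun x => f x * g x) μ :=
  hf.integrable_mul hg

lemma memLp_coord {μ : Measure (Space d)} {f : Space d → Space d} (hf : MemLp f 2 μ)
    (k : Fin d) : MemLp (fun x => f x k) 2 μ :=
  (EuclideanSpace.proj (𝕜 := ℝ) k : Space d →L[ℝ] ℝ).comp_memLp' hf

lemma integrable_inner' {μ : Measure (Space d)} {f g : Space d → Space d} (hf : MemLp f 2 μ)
    (hg : MemLp g 2 μ) : Integrable (fun x => (inner ℝ (f x) (g x) : ℝ)) μ :=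
  (L2.integrable_inner (𝕜 := ℝ) (hf.toLp f) (hg.toLp g)).congr (by
    filter_upwards [hf.coeFn_toLp, hg.coeFn_toLp] with x h1 h2
    rw [h1, h2])

lemma IsWeakGrad.unique {u : L2 U} {G G' : L2Vec U} (h : IsWeakGrad U u G)
    (h' : IsWeakGrad U u G') : G = G' := by
  have key : ∀ k : Fin d, ∀ᵐ x ∂(volume.restrict (U : Set (Space d))), G x k = G' x k := by
    intro k
    have m1 := memLp_coord (Lp.memLp G) k
    have m2 := memLp_coord (Lp.memLp G') k
    have := eq_zero_of_forall_test (U := U) (m1.toLp _ - m2.toLp _) (by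
      intro φ
      have e1 := h φ k
      have e2 := h' φ k
      have e3 : ∫ x in (U : Set (Space d)), (G x k * φ x - G' x k * φ x) = 0 := by
        rw [integral_sub (integrable_mul m1 (memLp_test φ _))
          (integrable_mul m2 (memLp_test φ _))]
        linarith
      rw [← e3]
      refine integral_congr_ae ?_
      filter_upwards [Lp.coeFn_sub (m1.toLp _) (m2.toLp _), m1.coeFn_toLp, m2.coeFn_toLp]
        with x h1 h2 h3
      rw [h1, Pi.sub_apply, h2, h3, sub_mul])
    rw [sub_eq_zero] at this
    exact (MemLp.toLp_eq_toLp_iff m1 m2).1 this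
  refine Lp.ext ?_
  filter_upwards [ae_all_iff.2 key] with x hx
  ext k
  exact hx k

lemma IsWeakGrad.add {u v : L2 U} {G H : L2Vec U} (hu : IsWeakGrad U u G)
    (hv : IsWeakGrad U v H) : IsWeakGrad U (u + v) (G + H) := by
  intro φ k
  have g := memLp_coord (memLp_gradient φ (volume.restrict (U : Set (Space d)))) k
  have f := memLp_test φ (volume.restrict (U : Set (Space d)))
  calc ∫ x in (U : Set (Space d)), (u + v : L2 U) x * (gradient φ x) k
      = ∫ x in (U : Set (Space d)), (u x * (gradient φ x) k + v x * (gradient φ x) k) := by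
        refine integral_congr_ae ?_
        filter_upwards [Lp.coeFn_add u v] with x hx
        rw [hx, Pi.add_apply, add_mul]
    _ = -∫ x in (U : Set (Space d)), ((G x) k * φ x + (H x) k * φ x) := by
        rw [integral_add (integrable_mul (Lp.memLp u) g) (integrable_mul (Lp.memLp v) g),
          integral_add (integrable_mul (memLp_coord (Lp.memLp G) k) f)
            (integrable_mul (memLp_coord (Lp.memLp H) k) f), hu φ k, hv φ k]
        ring
    _ = _ := by
        congr 1
        refine integral_congr_ae ?_
        filter_upwards [Lp.coeFn_add G H] with x hx
        rw [hx, Pi.add_apply, PiLp.add_apply, add_mul]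

lemma IsWeakGrad.smul (c : ℝ) {u : L2 U} {G : L2Vec U} (hu : IsWeakGrad U u G) :
    IsWeakGrad U (c • u) (c • G) := by
  intro φ k
  calc ∫ x in (U : Set (Space d)), (c • u : L2 U) x * (gradient φ x) k
      = ∫ x in (U : Set (Space d)), c * (u x * (gradient φ x) k) := by
        refine integral_congr_ae ?_
        filter_upwards [Lp.coeFn_smul c u] with x hx
        rw [hx, Pi.smul_apply, smul_eq_mul, mul_assoc]
    _ = -∫ x in (U : Set (Space d)), c * ((G x) k * φ x) := by
        rw [integral_const_mul, integral_const_mul, hu φ k]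
        ring
    _ = _ := by
        congr 1
        refine integral_congr_ae ?_
        filter_upwards [Lp.coeFn_smul c G] with x hx
        rw [hx, Pi.smul_apply, PiLp.smul_apply, smul_eq_mul, mul_assoc]

lemma isWeakGrad_zero : IsWeakGrad U 0 0 := by
  intro φ k
  have h1 : ∫ x in (U : Set (Space d)), (0 : L2 U) x * (gradient φ x) k = 0 := by
    refine integral_eq_zero_of_ae ?_
    filter_upwards [Lp.coeFn_zero ℝ 2 (volume.restrict (U : Set (Space d)))] with x hx
    rw [hx]; simp
  have h2 : ∫ x in (U : Set (Space d)), ((0 : L2Vec U) x) k * φ x = 0 := by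
    refine integral_eq_zero_of_ae ?_
    filter_upwards [Lp.coeFn_zero (Space d) 2 (volume.restrict (U : Set (Space d)))] with x hx
    rw [hx]; simp
  rw [h1, h2, neg_zero]

lemma weakGrad_spec {u : L2 U} (h : ∃ G, IsWeakGrad U u G) : IsWeakGrad U u (weakGrad U u) := by
  rw [weakGrad, dif_pos h]
  exact h.choose_spec

lemma IsWeakGrad.weakGrad_eq {u : L2 U} {G : L2Vec U} (h : IsWeakGrad U u G) :
    weakGrad U u = G :=
  (weakGrad_spec ⟨G, h⟩).unique h

lemma IsWeakDiv.unique {σ : Space d → Space d} {f f' : L2 U} (h : IsWeakDiv U σ f)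
    (h' : IsWeakDiv U σ f') : f = f' := by
  rw [← sub_eq_zero]
  refine eq_zero_of_forall_test _ fun φ => ?_
  have m := memLp_test φ (volume.restrict (U : Set (Space d)))
  have e1 := h φ
  have e2 := h' φ
  have e3 : ∫ x in (U : Set (Space d)), (f x * φ x - f' x * φ x) = 0 := by
    rw [integral_sub (integrable_mul (Lp.memLp f) m) (integrable_mul (Lp.memLp f') m)]
    linarith
  rw [← e3]
  refine integral_congr_ae ?_
  filter_upwards [Lp.coeFn_sub f f'] with x hx
  rw [hx, Pi.sub_apply, sub_mul]

lemma IsWeakDiv.congr {σ τ : Space d → Space d} {f : L2 U} (h : IsWeakDiv U σ f)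
    (e : σ =ᵐ[volume.restrict (U : Set (Space d))] τ) : IsWeakDiv U τ f := by
  intro φ
  rw [← h φ]
  refine integral_congr_ae ?_
  filter_upwards [e] with x hx
  rw [hx]

lemma IsWeakDiv.add {σ τ : Space d → Space d} {f g : L2 U}
    (mσ : MemLp σ 2 (volume.restrict (U : Set (Space d))))
    (mτ : MemLp τ 2 (volume.restrict (U : Set (Space d))))
    (h : IsWeakDiv U σ f) (h' : IsWeakDiv U τ g) : IsWeakDiv U (σ + τ) (f + g) := by
  intro φ
  have m := memLp_test φ (volume.restrict (U : Set (Space d)))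
  have m' := memLp_gradient φ (volume.restrict (U : Set (Space d)))
  simp only [Pi.add_apply, inner_add_left]
  rw [integral_add (integrable_inner' mσ m') (integrable_inner' mτ m'), h φ, h' φ, ← neg_add,
    ← integral_add (integrable_mul (Lp.memLp f) m) (integrable_mul (Lp.memLp g) m)]
  congr 1
  refine integral_congr_ae ?_
  filter_upwards [Lp.coeFn_add f g] with x hx
  rw [hx, Pi.add_apply, add_mul]

lemma IsWeakDiv.smul (c : ℝ) {σ : Space d → Space d} {f : L2 U} (h : IsWeakDiv U σ f) :
    IsWeakDiv U (c • σ) (c • f) := by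
  intro φ
  simp only [Pi.smul_apply, real_inner_smul_left]
  rw [integral_const_mul, h φ, mul_neg, ← integral_const_mul]
  congr 1
  refine integral_congr_ae ?_
  filter_upwards [Lp.coeFn_smul c f] with x hx
  rw [hx, Pi.smul_apply, smul_eq_mul, mul_assoc]

lemma MemHdiv.isWeakDiv {σ : Space d → Space d} (h : MemHdiv U σ) :
    IsWeakDiv U σ (weakDiv U σ) := by
  rw [weakDiv, dif_pos h.2]
  exact h.2.choose_spec

lemma IsWeakDiv.weakDiv_eq {σ : Space d → Space d} {f : L2 U} (h : IsWeakDiv U σ f) :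
    weakDiv U σ = f := by
  have h' : ∃ f, IsWeakDiv U σ f := ⟨f, h⟩
  rw [weakDiv, dif_pos h']
  exact h'.choose_spec.unique h

lemma MemHdiv.congr {σ τ : Space d → Space d} (h : MemHdiv U σ)
    (e : σ =ᵐ[volume.restrict (U : Set (Space d))] τ) : MemHdiv U τ :=
  ⟨h.1.ae_eq e, _, h.isWeakDiv.congr e⟩

lemma MemHdiv.add {σ τ : Space d → Space d} (h : MemHdiv U σ) (h' : MemHdiv U τ) :
    MemHdiv U (σ + τ) :=
  ⟨h.1.add h'.1, _, h.isWeakDiv.add h.1 h'.1 h'.isWeakDiv⟩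

lemma MemHdiv.smul (c : ℝ) {σ : Space d → Space d} (h : MemHdiv U σ) : MemHdiv U (c • σ) :=
  ⟨h.1.const_smul c, _, h.isWeakDiv.smul c⟩

lemma normalTrace_congr {σ τ : Space d → Space d} (h : MemHdiv U σ)
    (e : σ =ᵐ[volume.restrict (U : Set (Space d))] τ) (φ : Space d → ℝ) :
    normalTrace U σ φ = normalTrace U τ φ := by
  have : weakDiv U τ = weakDiv U σ := (h.isWeakDiv.congr e).weakDiv_eq
  rw [normalTrace, normalTrace, this]
  refine integral_congr_ae ?_
  filter_upwards [e] with x hx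
  rw [hx]

lemma normalTrace_add {σ τ : Space d → Space d} (h : MemHdiv U σ) (h' : MemHdiv U τ)
    {V : Opens (Space d)} (φ : 𝓓(V, ℝ)) :
    normalTrace U (σ + τ) φ = normalTrace U σ φ + normalTrace U τ φ := by
  have m := memLp_test φ (volume.restrict (U : Set (Space d)))
  have m' := memLp_gradient φ (volume.restrict (U : Set (Space d)))
  have e : weakDiv U (σ + τ) = weakDiv U σ + weakDiv U τ :=
    (h.isWeakDiv.add h.1 h'.1 h'.isWeakDiv).weakDiv_eq
  have i1 : Integrable (fun x => inner ℝ (σ x) (gradient φ x) + weakDiv U σ x * φ x)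
      (volume.restrict (U : Set (Space d))) :=
    (integrable_inner' h.1 m').add (integrable_mul (Lp.memLp _) m)
  have i2 : Integrable (fun x => inner ℝ (τ x) (gradient φ x) + weakDiv U τ x * φ x)
      (volume.restrict (U : Set (Space d))) :=
    (integrable_inner' h'.1 m').add (integrable_mul (Lp.memLp _) m)
  rw [normalTrace, normalTrace, normalTrace, ← integral_add i1 i2, e]
  refine integral_congr_ae ?_
  filter_upwards [Lp.coeFn_add (weakDiv U σ) (weakDiv U τ)] with x hx
  rw [hx]
  simp only [Pi.add_apply, inner_add_left]
  ring

lemma normalTrace_smul (c : ℝ) {σ : Space d → Space d} (h : MemHdiv U σ) (φ : Space d → ℝ) :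
    normalTrace U (c • σ) φ = c * normalTrace U σ φ := by
  have e : weakDiv U (c • σ) = c • weakDiv U σ := (h.isWeakDiv.smul c).weakDiv_eq
  rw [normalTrace, normalTrace, ← integral_const_mul, e]
  refine integral_congr_ae ?_
  filter_upwards [Lp.coeFn_smul c (weakDiv U σ)] with x hx
  rw [hx]
  simp only [Pi.smul_apply, real_inner_smul_left, smul_eq_mul]
  ring

end Helpers

/-- `H¹₀(U)`: the `u ∈ L²(U)` with weak gradient in `L²(U)ᵈ` that are limits in the `H¹` norm of
functions in `C_c^∞(U)`. -/
def H10 {d : ℕ} (U : Opens (Space d)) : Submodule ℝ (L2 U) where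
  carrier := {u | (∃ G, IsWeakGrad U u G) ∧ ∃ φ : ℕ → 𝓓(U, ℝ),
    Tendsto (fun n => eLpNorm (fun x => φ n x - u x) 2 (volume.restrict (U : Set (Space d))))
      atTop (𝓝 0) ∧
    Tendsto (fun n => eLpNorm (fun x => gradient (φ n) x - weakGrad U u x) 2
      (volume.restrict (U : Set (Space d)))) atTop (𝓝 0)}
  zero_mem' := by
    refine ⟨⟨0, isWeakGrad_zero⟩, fun _ => 0, ?_, ?_⟩
    · refine tendsto_const_nhds.congr fun n => ?_
      symm
      rw [← eLpNorm_zero (α := Space d) (ε := ℝ) (p := 2)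
        (μ := volume.restrict (U : Set (Space d)))]
      refine eLpNorm_congr_ae ?_
      filter_upwards [Lp.coeFn_zero ℝ 2 (volume.restrict (U : Set (Space d)))] with x hx
      rw [hx]; simp
    · refine tendsto_const_nhds.congr fun n => ?_
      symm
      rw [← eLpNorm_zero (α := Space d) (ε := Space d) (p := 2)
        (μ := volume.restrict (U : Set (Space d))), isWeakGrad_zero.weakGrad_eq]
      refine eLpNorm_congr_ae ?_
      filter_upwards [Lp.coeFn_zero (Space d) 2 (volume.restrict (U : Set (Space d)))] with x hx
      have := gradient_smul_test (U := U) 0 0 x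
      rw [zero_smul, zero_smul] at this
      rw [hx]
      simpa using this
  add_mem' := by
    rintro u v ⟨hu, φ, h1, h2⟩ ⟨hv, ψ, h3, h4⟩
    have hG := (weakGrad_spec hu).add (weakGrad_spec hv)
    refine ⟨⟨_, hG⟩, fun n => φ n + ψ n, ?_, ?_⟩
    · refine tendsto_of_tendsto_of_tendsto_of_le_of_le tendsto_const_nhds
        (by simpa using h1.add h3) (fun _ => zero_le) fun n => ?_
      refine le_trans (eLpNorm_congr_ae ?_).le (eLpNorm_add_le
        ((memLp_test (φ n) _).sub (Lp.memLp u)).1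
        ((memLp_test (ψ n) _).sub (Lp.memLp v)).1 (by norm_num))
      filter_upwards [Lp.coeFn_add u v] with x hx
      have e : (φ n + ψ n : 𝓓(U, ℝ)) x = φ n x + ψ n x := by simp
      simp only [hx, Pi.add_apply, e]
      ring
    · refine tendsto_of_tendsto_of_tendsto_of_le_of_le tendsto_const_nhds
        (by simpa using h2.add h4) (fun _ => zero_le) fun n => ?_
      rw [hG.weakGrad_eq]
      refine le_trans (eLpNorm_congr_ae ?_).le (eLpNorm_add_le
        ((memLp_gradient (φ n) _).sub (Lp.memLp (weakGrad U u))).1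
        ((memLp_gradient (ψ n) _).sub (Lp.memLp (weakGrad U v))).1 (by norm_num))
      filter_upwards [Lp.coeFn_add (weakGrad U u) (weakGrad U v)] with x hx
      simp only [hx, Pi.add_apply, gradient_add_test]
      abel
  smul_mem' := by
    rintro c u ⟨hu, φ, h1, h2⟩
    have hG := (weakGrad_spec hu).smul c
    refine ⟨⟨_, hG⟩, fun n => c • φ n, ?_, ?_⟩
    · have := ENNReal.Tendsto.const_mul (a := ‖c‖ₑ) h1 (Or.inr (by simp))
      rw [mul_zero] at this
      refine this.congr fun n => ?_
      rw [← eLpNorm_const_smul]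
      refine eLpNorm_congr_ae ?_
      filter_upwards [Lp.coeFn_smul c u] with x hx
      simp [hx, mul_sub]
    · have := ENNReal.Tendsto.const_mul (a := ‖c‖ₑ) h2 (Or.inr (by simp))
      rw [mul_zero] at this
      refine this.congr fun n => ?_
      rw [← eLpNorm_const_smul, hG.weakGrad_eq]
      refine eLpNorm_congr_ae ?_
      filter_upwards [Lp.coeFn_smul c (weakGrad U u)] with x hx
      simp only [hx, Pi.smul_apply, gradient_smul_test, smul_sub]

/-! ### The partition and its interfaces -/

/-- The open box `∏ₖ (aₖ, bₖ)`: an open interval for `d = 1`, an open axis-aligned rectangle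
for `d = 2`. -/
def openBox {d : ℕ} (a b : Fin d → ℝ) : Opens (Space d) where
  carrier := {x | ∀ k, a k < x k ∧ x k < b k}
  is_open' := by
    have : {x : Space d | ∀ k, a k < x k ∧ x k < b k} =
        ⋂ k, ({x : Space d | a k < x k} ∩ {x : Space d | x k < b k}) := by
      ext; simp
    rw [this]
    refine isOpen_iInter_of_finite fun k => ?_
    exact (isOpen_lt (by fun_prop) (by fun_prop)).inter (isOpen_lt (by fun_prop) (by fun_prop))

/-- A partition of the open box `Ω = ∏ₖ (aₖ, bₖ)` into finitely many non-overlapping nonempty open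
boxes `Ω₁, …, Ω_I`. -/
structure BoxPartition {d : ℕ} (a b : Fin d → ℝ) where
  /-- the number `I` of subdomains -/
  card : ℕ
  lower : Fin card → Fin d → ℝ
  upper : Fin card → Fin d → ℝ
  lower_lt_upper : ∀ i k, lower i k < upper i k
  subset : ∀ i, (openBox (lower i) (upper i) : Set (Space d)) ⊆ openBox a b
  disjoint : ∀ i j, i ≠ j → Disjoint (openBox (lower i) (upper i) : Set (Space d))
    (openBox (lower j) (upper j))
  cover : closure (openBox a b : Set (Space d)) =
    ⋃ i, closure (openBox (lower i) (upper i) : Set (Space d))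

namespace BoxPartition

variable {d : ℕ} {a b : Fin d → ℝ}

/-- The subdomain `Ωᵢ`. -/
def cell (P : BoxPartition a b) (i : Fin P.card) : Opens (Space d) :=
  openBox (P.lower i) (P.upper i)

/-- The set `Γ` of interior interfaces: the points of `Ω` on a common boundary `∂Ωᵢ ∩ ∂Ωⱼ`,
`i ≠ j`. -/
def interface (P : BoxPartition a b) : Set (Space d) :=
  (openBox a b : Set (Space d)) ∩ {x | ∃ i j : Fin P.card, i ≠ j ∧
    x ∈ frontier (P.cell i : Set (Space d)) ∩ frontier (P.cell j : Set (Space d))}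

/-- The surface measure on `Γ`: the `(d-1)`-dimensional Hausdorff measure, normalized so that
it is the counting measure for `d = 1`, length for `d = 2`, area for `d = 3`. -/
def surface (P : BoxPartition a b) : Measure (Space d) :=
  (Measure.euclideanHausdorffMeasure (d - 1)).restrict P.interface

/-- The piecewise constant coefficient with value `pᵢ` on `Ωᵢ`. -/
def coeff (P : BoxPartition a b) (p : Fin P.card → ℝ) (x : Space d) : ℝ :=
  ∑ i, (P.cell i : Set (Space d)).indicator (fun _ => p i) x

/-- The flux `p∇u`. -/
def flux (P : BoxPartition a b) (p : Fin P.card → ℝ) (u : L2 (openBox a b)) :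
    Space d → Space d :=
  fun x => P.coeff p x • weakGrad (openBox a b) u x

/-- `g ∈ L²(Γ)` is the jump `[σ · n]` of a field `σ` that belongs to `H(div, Ωᵢ)` for all `i`: the
sum over the subdomains of the (outward) normal traces of `σ`, as a functional on `C_c^∞(Ω)`,
is `φ ↦ ∫_Γ g φ dS`. -/
def IsJump (P : BoxPartition a b) (σ : Space d → Space d) (g : Lp ℝ 2 P.surface) : Prop :=
  ∀ φ : 𝓓(openBox a b, ℝ), ∑ i, normalTrace (P.cell i) σ φ = ∫ x, g x * φ x ∂P.surface

open Classical in
/-- The jump `[σ · n] ∈ L²(Γ)` (it is unique; the value is `0` if there is none). -/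
def jump (P : BoxPartition a b) (σ : Space d → Space d) : Lp ℝ 2 P.surface :=
  if h : ∃ g, P.IsJump σ g then h.choose else 0

lemma frontier_openBox_subset (l u : Fin d → ℝ) :
    frontier (openBox l u : Set (Space d)) ⊆
      ⋃ k, ({x : Space d | x k = l k} ∪ {x : Space d | x k = u k}) := by
  intro x hx
  have hcl : ∀ k, l k ≤ x k ∧ x k ≤ u k := by
    have hc : IsClosed {x : Space d | ∀ k, l k ≤ x k ∧ x k ≤ u k} := by
      have : {x : Space d | ∀ k, l k ≤ x k ∧ x k ≤ u k} =
          ⋂ k, ({x : Space d | l k ≤ x k} ∩ {x : Space d | x k ≤ u k}) := by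
        ext; simp
      rw [this]
      exact isClosed_iInter fun k => (isClosed_le (by fun_prop) (by fun_prop)).inter
        (isClosed_le (by fun_prop) (by fun_prop))
    exact closure_minimal (fun y hy k => ⟨(hy k).1.le, (hy k).2.le⟩) hc hx.1
  have hno : x ∉ (openBox l u : Set (Space d)) := by
    have := hx.2
    rwa [(openBox l u).isOpen.interior_eq] at this
  by_contra hcon
  simp only [Set.mem_iUnion, Set.mem_union, Set.mem_ofPred_eq, not_exists, not_or] at hcon
  exact hno fun k => ⟨lt_of_le_of_ne (hcl k).1 (Ne.symm (hcon k).1),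
    lt_of_le_of_ne (hcl k).2 (hcon k).2⟩

lemma hausdorff_slice_lt_top (l u : Fin d → ℝ) (k : Fin d) (c : ℝ) :
    (Measure.euclideanHausdorffMeasure (d - 1) : Measure (Space d))
      ({x | x k = c} ∩ (openBox l u : Set (Space d))) < ⊤ := by
  cases d with
  | zero => exact k.elim0
  | succ n =>
    let f : Space n → Space (n + 1) := fun y => WithLp.toLp 2 (k.insertNth c (fun j => y j))
    have hf : Isometry f := by
      refine Isometry.of_dist_eq fun y z => ?_
      rw [EuclideanSpace.dist_eq, EuclideanSpace.dist_eq, Fin.sum_univ_succAbove _ k]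
      simp [f]
    have hsub : ({x | x k = c} ∩ (openBox l u : Set (Space (n + 1)))) ⊆
        f '' (openBox (fun j => l (k.succAbove j)) (fun j => u (k.succAbove j)) :
          Set (Space n)) := by
      rintro x ⟨hx, hx'⟩
      refine ⟨WithLp.toLp 2 fun j => x (k.succAbove j), fun j => hx' _, ?_⟩
      ext j
      refine Fin.succAboveCases k ?_ (fun j => ?_) j
      · simpa [f] using hx.symm
      · simp [f]
    refine (measure_mono hsub).trans_lt ?_
    rw [Nat.add_sub_cancel, hf.euclideanHausdorffMeasure_image,
      EuclideanSpace.euclideanHausdorffMeasure_eq_volume]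
    have hb : (openBox (fun j => l (k.succAbove j)) (fun j => u (k.succAbove j)) :
        Set (Space n)) ⊆ (MeasurableEquiv.toLp 2 (Fin n → ℝ)).symm ⁻¹'
          Set.Icc (fun j => l (k.succAbove j)) (fun j => u (k.succAbove j)) :=
      fun y hy => ⟨fun j => (hy j).1.le, fun j => (hy j).2.le⟩
    refine (measure_mono hb).trans_lt ?_
    rw [(EuclideanSpace.volume_preserving_symm_measurableEquiv_toLp (Fin n)).measure_preimage_equiv]
    exact isCompact_Icc.measure_lt_top

instance (P : BoxPartition a b) : IsFiniteMeasure P.surface := by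
  refine ⟨?_⟩
  rw [surface, Measure.restrict_apply_univ]
  have hsub : P.interface ⊆ ⋃ i : Fin P.card, ⋃ k : Fin d,
      (({x | x k = P.lower i k} ∩ (openBox a b : Set (Space d))) ∪
        ({x | x k = P.upper i k} ∩ (openBox a b : Set (Space d)))) := by
    rintro x ⟨hx, i, j, -, hi, -⟩
    have := frontier_openBox_subset _ _ hi
    simp only [Set.mem_iUnion, Set.mem_union, Set.mem_inter_iff, Set.mem_ofPred_eq] at this ⊢
    obtain ⟨k, hk⟩ := this
    exact ⟨i, k, hk.imp (fun h => ⟨h, hx⟩) (fun h => ⟨h, hx⟩)⟩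
  refine (measure_mono hsub).trans_lt ?_
  refine (measure_iUnion_le _).trans_lt ?_
  rw [tsum_fintype, ENNReal.sum_lt_top]
  intro i _
  refine (measure_iUnion_le _).trans_lt ?_
  rw [tsum_fintype, ENNReal.sum_lt_top]
  intro k _
  exact (measure_union_le _ _).trans_lt
    (ENNReal.add_lt_top.2 ⟨hausdorff_slice_lt_top _ _ _ _, hausdorff_slice_lt_top _ _ _ _⟩)

lemma ae_cell_of_ae {P : BoxPartition a b} {q : Space d → Prop} (i : Fin P.card)
    (h : ∀ᵐ x ∂(volume.restrict (openBox a b : Set (Space d))), q x) :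
    ∀ᵐ x ∂(volume.restrict (P.cell i : Set (Space d))), q x :=
  ae_mono (Measure.restrict_mono (P.subset i) le_rfl) h

lemma flux_add (P : BoxPartition a b) (p : Fin P.card → ℝ) {u v : L2 (openBox a b)}
    (hu : u ∈ H10 (openBox a b)) (hv : v ∈ H10 (openBox a b)) :
    P.flux p u + P.flux p v =ᵐ[volume.restrict (openBox a b : Set (Space d))]
      P.flux p (u + v) := by
  have h := ((weakGrad_spec hu.1).add (weakGrad_spec hv.1)).weakGrad_eq
  filter_upwards [Lp.coeFn_add (weakGrad _ u) (weakGrad _ v)] with x hx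
  simp only [flux, Pi.add_apply, h, hx, smul_add]

lemma flux_smul (P : BoxPartition a b) (p : Fin P.card → ℝ) (c : ℝ) {u : L2 (openBox a b)}
    (hu : u ∈ H10 (openBox a b)) :
    c • P.flux p u =ᵐ[volume.restrict (openBox a b : Set (Space d))] P.flux p (c • u) := by
  have h := ((weakGrad_spec hu.1).smul c).weakGrad_eq
  filter_upwards [Lp.coeFn_smul c (weakGrad _ u)] with x hx
  simp only [flux, Pi.smul_apply, h, hx]
  rw [smul_comm]

lemma flux_zero (P : BoxPartition a b) (p : Fin P.card → ℝ) :
    (fun _ => 0) =ᵐ[volume.restrict (openBox a b : Set (Space d))] P.flux p 0 := by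
  filter_upwards [Lp.coeFn_zero (Space d) 2 (volume.restrict (openBox a b : Set (Space d)))]
    with x hx
  rw [flux, isWeakGrad_zero.weakGrad_eq, hx]; simp

/-! ### The space `𝕏ᵖ` and its norms -/

/-- `𝕏ᵖ = {u ∈ H¹₀(Ω) : (p∇u)|_{Ωᵢ} ∈ H(div, Ωᵢ) for all i, [p∇u · n] ∈ L²(Γ)}`. -/
def Xp (P : BoxPartition a b) (p : Fin P.card → ℝ) : Submodule ℝ (L2 (openBox a b)) where
  carrier := {u | u ∈ H10 (openBox a b) ∧ (∀ i, MemHdiv (P.cell i) (P.flux p u)) ∧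
    ∃ g, P.IsJump (P.flux p u) g}
  zero_mem' := by
    have h0 : ∀ i, IsWeakDiv (P.cell i) (fun _ => 0) 0 := by
      intro i φ
      rw [integral_eq_zero_of_ae (f := fun x => (0 : L2 (P.cell i)) x * φ x)]
      · simp
      · filter_upwards [Lp.coeFn_zero ℝ 2 (volume.restrict (P.cell i : Set (Space d)))] with x hx
        rw [hx]; simp
    have h1 : ∀ i, MemHdiv (P.cell i) (fun _ => 0) := fun i => ⟨MemLp.zero', 0, h0 i⟩
    refine ⟨Submodule.zero_mem _, fun i => (h1 i).congr (ae_cell_of_ae i (P.flux_zero p)),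
      0, fun φ => ?_⟩
    rw [integral_eq_zero_of_ae (f := fun x => (0 : Lp ℝ 2 P.surface) x * φ x)]
    · refine Finset.sum_eq_zero fun i _ => ?_
      rw [← normalTrace_congr (h1 i) (ae_cell_of_ae i (P.flux_zero p)), normalTrace,
        (h0 i).weakDiv_eq]
      refine integral_eq_zero_of_ae ?_
      filter_upwards [Lp.coeFn_zero ℝ 2 (volume.restrict (P.cell i : Set (Space d)))] with x hx
      rw [hx]; simp
    · filter_upwards [Lp.coeFn_zero ℝ 2 P.surface] with x hx
      rw [hx]; simp
  add_mem' := by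
    rintro u v ⟨hu, hu', g, hg⟩ ⟨hv, hv', g', hg'⟩
    have e := P.flux_add p hu hv
    refine ⟨Submodule.add_mem _ hu hv, fun i => ((hu' i).add (hv' i)).congr (ae_cell_of_ae i e),
      g + g', fun φ => ?_⟩
    have m := memLp_test φ P.surface
    calc ∑ i, normalTrace (P.cell i) (P.flux p (u + v)) φ
        = ∑ i, (normalTrace (P.cell i) (P.flux p u) φ
            + normalTrace (P.cell i) (P.flux p v) φ) := by
          refine Finset.sum_congr rfl fun i _ => ?_
          rw [← normalTrace_congr ((hu' i).add (hv' i)) (ae_cell_of_ae i e),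
            normalTrace_add (hu' i) (hv' i)]
      _ = ∫ x, (g x * φ x + g' x * φ x) ∂P.surface := by
          rw [Finset.sum_add_distrib, hg φ, hg' φ, integral_add
            (integrable_mul (Lp.memLp g) m) (integrable_mul (Lp.memLp g') m)]
      _ = _ := by
          refine integral_congr_ae ?_
          filter_upwards [Lp.coeFn_add g g'] with x hx
          rw [hx, Pi.add_apply, add_mul]
  smul_mem' := by
    rintro c u ⟨hu, hu', g, hg⟩
    have e := P.flux_smul p c hu
    refine ⟨Submodule.smul_mem _ c hu, fun i => ((hu' i).smul c).congr (ae_cell_of_ae i e),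
      c • g, fun φ => ?_⟩
    calc ∑ i, normalTrace (P.cell i) (P.flux p (c • u)) φ
        = ∑ i, c * normalTrace (P.cell i) (P.flux p u) φ := by
          refine Finset.sum_congr rfl fun i _ => ?_
          rw [← normalTrace_congr ((hu' i).smul c) (ae_cell_of_ae i e),
            normalTrace_smul c (hu' i)]
      _ = ∫ x, c * (g x * φ x) ∂P.surface := by
          rw [← Finset.mul_sum, hg φ, integral_const_mul]
      _ = _ := by
          refine integral_congr_ae ?_
          filter_upwards [Lp.coeFn_smul c g] with x hx
          rw [hx, Pi.smul_apply, smul_eq_mul, mul_assoc]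

/-- `‖u‖_{H¹₀} = ‖∇u‖_{L²(Ω)}`. -/
def normH10 (_P : BoxPartition a b) (u : L2 (openBox a b)) : ℝ :=
  ‖weakGrad (openBox a b) u‖

/-- The piecewise divergence `div(p∇u)` on `Ω ∖ Γ`. -/
def divFlux (P : BoxPartition a b) (p : Fin P.card → ℝ) (u : L2 (openBox a b)) (x : Space d) : ℝ :=
  ∑ i, (P.cell i : Set (Space d)).indicator (fun y => weakDiv (P.cell i) (P.flux p u) y) x

/-- The jump `[p∇u · n] ∈ L²(Γ)`. -/
def jumpFlux (P : BoxPartition a b) (p : Fin P.card → ℝ) (u : L2 (openBox a b)) :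
    Lp ℝ 2 P.surface :=
  P.jump (P.flux p u)

/-- The residual norm `(‖div(p∇u)‖²_{L²(Ω)} + Θ ‖[p∇u · n]‖²_{L²(Γ)})^{1/2}`. -/
def resNorm (P : BoxPartition a b) (p : Fin P.card → ℝ) (Θ : ℝ) (u : L2 (openBox a b)) : ℝ :=
  √((lpNorm (P.divFlux p u) 2 (volume.restrict (openBox a b : Set (Space d)))) ^ 2
    + Θ * ‖P.jumpFlux p u‖ ^ 2)

/-- The graph norm
`(‖u‖²_{H¹₀} + ∑ᵢ ‖div(p∇u)‖²_{L²(Ωᵢ)} + ‖[p∇u · n]‖²_{L²(Γ)})^{1/2}`. -/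
def graphNorm (P : BoxPartition a b) (p : Fin P.card → ℝ) (u : L2 (openBox a b)) : ℝ :=
  √((P.normH10 u) ^ 2 + ∑ i, ‖weakDiv (P.cell i) (P.flux p u)‖ ^ 2 + ‖P.jumpFlux p u‖ ^ 2)

/-- `w` is the weak solution of the transmission problem with source `ℓ`:
`w ∈ H¹₀(Ω)` and `∫_Ω p∇w · ∇v = ∫_Ω ℓ v` for all `v ∈ H¹₀(Ω)`. -/
def IsWeakSolution (P : BoxPartition a b) (p : Fin P.card → ℝ) (ℓ w : L2 (openBox a b)) : Prop :=
  w ∈ H10 (openBox a b) ∧ ∀ v ∈ H10 (openBox a b),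
    ∫ x in (openBox a b : Set (Space d)), inner ℝ (P.flux p w x) (weakGrad (openBox a b) v x) =
      ∫ x in (openBox a b : Set (Space d)), ℓ x * v x

end BoxPartition

/-- `N` is a norm on the real vector space `V`. -/
def IsNorm {V : Type*} [AddCommGroup V] [Module ℝ V] (N : V → ℝ) : Prop :=
  (∀ u v, N (u + v) ≤ N u + N v) ∧ (∀ (c : ℝ) (u : V), N (c • u) = |c| * N u) ∧
    ∀ u, N u = 0 → u = 0

end

end Transmission

namespace Transmission

noncomputable section

/-! ### Slices, the trace inequality and the Poincaré inequality -/

/-! The estimate is an energy argument. Summing the normal traces over the cells gives Green's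
identity for test functions, `∫_Ω p∇u·∇φ = ∫_Γ [p∇u·n] φ dS - ∫_Ω div(p∇u) φ` (`sum_normalTrace`).
Cauchy–Schwarz bounds the right side by the two residuals times `‖φ‖_{L²(Ω)}` and `‖φ‖_{L²(Γ)}`, and
both of these are controlled by `‖∇φ‖` through a Poincaré inequality and a trace inequality
(`exists_poincare`, `exists_trace`). Hence `|∫ p∇u·∇φ| ≤ A ‖∇φ‖` with `A` linear in the residuals.
Letting `φ` run through test functions converging to `u` in `H¹` gives `min p ‖∇u‖² ≤ A ‖∇u‖`
(`mul_normH10_le`). Only test functions are ever restricted to `Γ`, so no trace operator on `H¹₀` is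
needed.

Poincaré and trace inequalities have one source. On a line parallel to a coordinate axis a test
function vanishes outside an interval, so its square at a point is at most the length of the
interval times the integral of the squared derivative. Integrating over a hyperplane gives the trace
inequality there; integrating once more gives Poincaré. The interfaces lie in finitely many
coordinate hyperplanes.

For the norms, both quantities are norms of linear maps from `𝕏ᵖ` into Hilbert spaces, so only
definiteness needs an argument: the estimate gives `∇u = 0` and Poincaré gives `u = 0`. The
equivalence compares squares. Finally, a weak solution has divergence `-ℓ` on each cell and zero
jump, so part 3 is the estimate applied to the difference, together with linearity. -/

/-- Cauchy–Schwarz against the constant function `1`. -/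
lemma sq_lintegral_enorm_le {α : Type*} [MeasurableSpace α] {μ : Measure α} {f : α → ℝ}
    (hf : AEStronglyMeasurable f μ) :
    (∫⁻ x, ‖f x‖ₑ ∂μ) ^ 2 ≤ μ Set.univ * ∫⁻ x, ‖f x‖ₑ ^ 2 ∂μ := by
  have h := eLpNorm_le_eLpNorm_mul_rpow_measure_univ (p := 1) (q := 2) (by norm_num) hf
  rw [eLpNorm_one_eq_lintegral_enorm, eLpNorm_eq_lintegral_rpow_enorm_toReal (by norm_num)
    (by norm_num)] at h
  calc (∫⁻ x, ‖f x‖ₑ ∂μ) ^ 2 ≤ _ := pow_le_pow_left' h 2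
    _ = _ := by
      rw [mul_pow, mul_comm, ← ENNReal.rpow_natCast, ← ENNReal.rpow_natCast, ← ENNReal.rpow_mul,
        ← ENNReal.rpow_mul]
      norm_num

/-- The one-dimensional Friedrichs inequality. -/
lemma enorm_sq_le_lintegral_deriv {f : ℝ → ℝ} (hf : ContDiff ℝ 1 f) {a b : ℝ}
    (hs : ∀ t ∉ Set.Icc a b, f t = 0) (x : ℝ) :
    ‖f x‖ₑ ^ 2 ≤ ENNReal.ofReal (b - a) * ∫⁻ t, ‖deriv f t‖ₑ ^ 2 := by
  have hc : HasCompactSupport f := HasCompactSupport.intro isCompact_Icc hs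
  have hd : ∀ t ∉ Set.Icc a b, deriv f t = 0 := fun t ht => by
    have : f =ᶠ[𝓝 t] fun _ => 0 := by
      filter_upwards [isClosed_Icc.isOpen_compl.mem_nhds ht] with s hs' using hs s hs'
    rw [this.deriv_eq, deriv_const]
  -- Compact support bounds `f x` by the integral of `|f'|` over a half-line; since `f'` vanishes
  -- off `[a, b]`, only that interval counts, and Cauchy–Schwarz then contributes its length.
  have h1 : ‖f x‖ₑ ≤ ∫⁻ t in Set.Icc a b, ‖deriv f t‖ₑ := by
    refine (hc.enorm_le_lintegral_Ici_deriv hf x).trans ((setLIntegral_le_lintegral _ _).trans ?_)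
    rw [← lintegral_indicator measurableSet_Icc]
    refine lintegral_mono fun t => ?_
    by_cases ht : t ∈ Set.Icc a b
    · rw [Set.indicator_of_mem ht]
    · rw [hd t ht]; simp
  refine (pow_le_pow_left' h1 2).trans ((sq_lintegral_enorm_le
    (hf.continuous_deriv le_rfl).aestronglyMeasurable).trans ?_)
  rw [Measure.restrict_apply_univ, Real.volume_Icc]
  gcongr
  exact Measure.restrict_le_self

/-! ### Slicing along a coordinate direction -/

/-- The parametrization of the hyperplane `{x | x k = c}` by the other coordinates. -/
def sliceMap {n : ℕ} (k : Fin (n + 1)) (c : ℝ) (y : Fin n → ℝ) : Space (n + 1) :=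
  WithLp.toLp 2 (k.insertNth c y)

lemma measurePreserving_sliceMap {n : ℕ} (k : Fin (n + 1)) :
    MeasurePreserving (fun z : ℝ × (Fin n → ℝ) => sliceMap k z.1 z.2) := by
  have h1 := (volume_preserving_piFinSuccAbove (fun _ : Fin (n + 1) => ℝ) k).symm
  have h2 := (EuclideanSpace.volume_preserving_symm_measurableEquiv_toLp (Fin (n + 1))).symm
  exact h2.comp h1

/-- Tonelli with the slice variable outermost: this order integrates the trace bound over all
slices, for Poincaré. The variant with the slice variable innermost integrates the one-dimensional
inequality over all lines, for the trace bound. -/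
lemma lintegral_eq_lintegral_sliceMap {n : ℕ} (k : Fin (n + 1)) {F : Space (n + 1) → ℝ≥0∞}
    (hF : Measurable F) :
    ∫⁻ x, F x = ∫⁻ t : ℝ, ∫⁻ y : Fin n → ℝ, F (sliceMap k t y) := by
  have h := measurePreserving_sliceMap k
  rw [← h.lintegral_comp hF, Measure.volume_eq_prod, lintegral_prod]
  exact (hF.comp h.measurable).aemeasurable

lemma lintegral_eq_lintegral_sliceMap_symm {n : ℕ} (k : Fin (n + 1)) {F : Space (n + 1) → ℝ≥0∞}
    (hF : Measurable F) :
    ∫⁻ x, F x = ∫⁻ y : Fin n → ℝ, ∫⁻ t : ℝ, F (sliceMap k t y) := by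
  have h := measurePreserving_sliceMap k
  rw [← h.lintegral_comp hF, Measure.volume_eq_prod, lintegral_prod_symm]
  exact (hF.comp h.measurable).aemeasurable

/-- The parametrization is an isometry of `ℝⁿ` onto the hyperplane, and the normalized Hausdorff
measure on `ℝⁿ` is Lebesgue measure, so no Jacobian or constant appears. -/
lemma lintegral_hyperplane {n : ℕ} (k : Fin (n + 1)) (c : ℝ) {F : Space (n + 1) → ℝ≥0∞}
    (hF : Measurable F) :
    ∫⁻ x in {x | x k = c}, F x ∂(Measure.euclideanHausdorffMeasure n) =
      ∫⁻ y : Fin n → ℝ, F (sliceMap k c y) := by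
  let f : Space n → Space (n + 1) := fun y => sliceMap k c (fun j => y j)
  have hf : Isometry f := by
    refine Isometry.of_dist_eq fun y z => ?_
    rw [EuclideanSpace.dist_eq, EuclideanSpace.dist_eq, Fin.sum_univ_succAbove _ k]
    simp [f, sliceMap]
  have hr : Set.range f = {x | x k = c} := by
    ext x
    constructor
    · rintro ⟨y, rfl⟩
      simp [f, sliceMap]
    · intro hx
      refine ⟨WithLp.toLp 2 fun j => x (k.succAbove j), ?_⟩
      ext j
      refine Fin.succAboveCases k ?_ (fun j => ?_) j
      · simpa [f, sliceMap] using hx.symm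
      · simp [f, sliceMap]
  rw [← hr, ← hf.map_euclideanHausdorffMeasure,
    EuclideanSpace.euclideanHausdorffMeasure_eq_volume,
    lintegral_map hF hf.continuous.measurable]
  have h2 := (EuclideanSpace.volume_preserving_symm_measurableEquiv_toLp (Fin n)).symm
  exact (h2.lintegral_comp (hF.comp hf.continuous.measurable)).symm

lemma hasDerivAt_sliceMap {n : ℕ} (k : Fin (n + 1)) (t : ℝ) (y : Fin n → ℝ) :
    HasDerivAt (fun t => sliceMap k t y) (EuclideanSpace.single k (1 : ℝ)) t := by
  have e : ∀ t, sliceMap k t y = t • EuclideanSpace.single k (1 : ℝ) + sliceMap k 0 y := by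
    intro t
    ext j
    rcases Fin.eq_self_or_eq_succAbove k j with rfl | ⟨i, rfl⟩
    · simp only [sliceMap, PiLp.add_apply, PiLp.smul_apply, Fin.insertNth_apply_same]
      simp
    · simp only [sliceMap, PiLp.add_apply, PiLp.smul_apply, Fin.insertNth_apply_succAbove]
      simp
  rw [funext e]
  simpa using ((hasDerivAt_id t).smul_const
    (EuclideanSpace.single k (1 : ℝ) : Space (n + 1))).add_const (sliceMap k 0 y)

lemma contDiff_sliceMap {n : ℕ} (k : Fin (n + 1)) (y : Fin n → ℝ) :
    ContDiff ℝ 1 (fun t => sliceMap k t y) := by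
  rw [contDiff_one_iff_deriv]
  refine ⟨fun t => (hasDerivAt_sliceMap k t y).differentiableAt, ?_⟩
  have : deriv (fun t => sliceMap k t y) = fun _ => EuclideanSpace.single k (1 : ℝ) :=
    funext fun t => (hasDerivAt_sliceMap k t y).deriv
  rw [this]
  exact continuous_const

lemma fderiv_apply_eq_inner_gradient {d : ℕ} (φ : Space d → ℝ) (x v : Space d) :
    fderiv ℝ φ x v = inner ℝ (gradient φ x) v := by
  simp [gradient]

lemma test_eq_zero {d : ℕ} {U : Opens (Space d)} (φ : 𝓓(U, ℝ)) {x : Space d} (hx : x ∉ U) :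
    φ x = 0 :=
  image_eq_zero_of_notMem_tsupport fun h => hx (φ.tsupport_subset h)

lemma gradient_test_eq_zero {d : ℕ} {U : Opens (Space d)} (φ : 𝓓(U, ℝ)) {x : Space d}
    (hx : x ∉ U) : gradient φ x = 0 := by
  have : fderiv ℝ φ x = 0 :=
    image_eq_zero_of_notMem_tsupport fun h => hx (φ.tsupport_subset (tsupport_fderiv_subset ℝ h))
  rw [gradient, this, map_zero]

/-- The Friedrichs inequality on lines parallel to a coordinate axis. -/
lemma enorm_sq_test_sliceMap_le {n : ℕ} {a b : Fin (n + 1) → ℝ} (φ : 𝓓(openBox a b, ℝ))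
    (k : Fin (n + 1)) (c : ℝ) (y : Fin n → ℝ) :
    ‖φ (sliceMap k c y)‖ₑ ^ 2 ≤
      ENNReal.ofReal (b k - a k) * ∫⁻ t, ‖gradient φ (sliceMap k t y)‖ₑ ^ 2 := by
  refine (enorm_sq_le_lintegral_deriv (f := fun t => φ (sliceMap k t y)) (a := a k) (b := b k)
    ((φ.contDiff.of_le (by simp)).comp (contDiff_sliceMap k y)) (fun t ht => ?_) c).trans ?_
  · refine test_eq_zero φ fun h => ht ?_
    have := h k
    simp only [sliceMap, Fin.insertNth_apply_same] at this
    exact ⟨this.1.le, this.2.le⟩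
  · gcongr with t
    have := (((differentiable_test φ) (sliceMap k t y)).hasFDerivAt.comp_hasDerivAt t
      (hasDerivAt_sliceMap k t y)).deriv
    simp only [Function.comp_def] at this
    rw [this, fderiv_apply_eq_inner_gradient]
    rw [enorm_le_iff_norm_le]
    refine (norm_inner_le_norm _ _).trans ?_
    simp

lemma measurable_enorm_sq_gradient {d : ℕ} {U : Opens (Space d)} (φ : 𝓓(U, ℝ)) :
    Measurable fun x => ‖gradient φ x‖ₑ ^ 2 :=
  (continuous_gradient φ).enorm.measurable.pow_const 2

lemma measurable_enorm_sq_test {d : ℕ} {U : Opens (Space d)} (φ : 𝓓(U, ℝ)) :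
    Measurable fun x => ‖φ x‖ₑ ^ 2 :=
  φ.continuous.enorm.measurable.pow_const 2

/-- The trace inequality on a hyperplane orthogonal to a coordinate axis. -/
lemma lintegral_sliceMap_test_le {n : ℕ} {a b : Fin (n + 1) → ℝ} (φ : 𝓓(openBox a b, ℝ))
    (k : Fin (n + 1)) (c : ℝ) :
    ∫⁻ y : Fin n → ℝ, ‖φ (sliceMap k c y)‖ₑ ^ 2 ≤
      ENNReal.ofReal (b k - a k) * ∫⁻ x, ‖gradient φ x‖ₑ ^ 2 := by
  rw [lintegral_eq_lintegral_sliceMap_symm k (measurable_enorm_sq_gradient φ),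
    ← lintegral_const_mul' _ _ ENNReal.ofReal_ne_top]
  exact lintegral_mono fun y => enorm_sq_test_sliceMap_le φ k c y

/-- The Poincaré–Friedrichs inequality for test functions. -/
lemma lintegral_test_le {n : ℕ} {a b : Fin (n + 1) → ℝ} (φ : 𝓓(openBox a b, ℝ))
    (k : Fin (n + 1)) :
    ∫⁻ x, ‖φ x‖ₑ ^ 2 ≤
      ENNReal.ofReal (b k - a k) ^ 2 * ∫⁻ x, ‖gradient φ x‖ₑ ^ 2 := by
  rw [lintegral_eq_lintegral_sliceMap k (measurable_enorm_sq_test φ)]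
  calc ∫⁻ t : ℝ, ∫⁻ y : Fin n → ℝ, ‖φ (sliceMap k t y)‖ₑ ^ 2
      -- Slices outside `[a k, b k]` miss the box and contribute nothing; on the others the trace
      -- bound is uniform in `t`, whence the second factor `b k - a k`.
      ≤ ∫⁻ t in Set.Icc (a k) (b k), ENNReal.ofReal (b k - a k) *
          ∫⁻ x, ‖gradient φ x‖ₑ ^ 2 := by
        rw [← lintegral_indicator measurableSet_Icc]
        refine lintegral_mono fun t => ?_
        by_cases ht : t ∈ Set.Icc (a k) (b k)
        · rw [Set.indicator_of_mem ht]
          exact lintegral_sliceMap_test_le φ k t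
        · have : ∀ y, φ (sliceMap k t y) = 0 := fun y => test_eq_zero φ fun h => ht (by
            have := h k
            simp only [sliceMap, Fin.insertNth_apply_same] at this
            exact ⟨this.1.le, this.2.le⟩)
          simp [this]
    _ = _ := by
        rw [setLIntegral_const, Real.volume_Icc, sq]
        ring

lemma eLpNorm_two_sq {α E : Type*} [MeasurableSpace α] [NormedAddCommGroup E] {μ : Measure α}
    (f : α → E) : eLpNorm f 2 μ ^ 2 = ∫⁻ x, ‖f x‖ₑ ^ 2 ∂μ := by
  rw [eLpNorm_eq_lintegral_rpow_enorm_toReal (by norm_num) (by norm_num), ← ENNReal.rpow_natCast,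
    ← ENNReal.rpow_mul]
  norm_num

lemma lintegral_gradient_test {d : ℕ} {U : Opens (Space d)} (φ : 𝓓(U, ℝ)) :
    ∫⁻ x, ‖gradient φ x‖ₑ ^ 2 =
      eLpNorm (gradient φ) 2 (volume.restrict (U : Set (Space d))) ^ 2 := by
  rw [eLpNorm_two_sq, ← lintegral_indicator U.isOpen.measurableSet]
  refine lintegral_congr fun x => ?_
  by_cases hx : x ∈ (U : Set (Space d))
  · rw [Set.indicator_of_mem hx]
  · rw [Set.indicator_of_notMem hx, gradient_test_eq_zero φ hx]
    simp

lemma eLpNorm_le_of_sq_le {x y K : ℝ≥0∞} (h : x ^ 2 ≤ K * y ^ 2) : x ≤ K ^ (2⁻¹ : ℝ) * y := by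
  have e : (K ^ (2⁻¹ : ℝ) * y) ^ 2 = K * y ^ 2 := by
    rw [mul_pow, ← ENNReal.rpow_natCast, ← ENNReal.rpow_mul]
    norm_num
  rw [← e] at h
  exact (ENNReal.pow_le_pow_left_iff two_ne_zero).1 h

/-- The Poincaré–Friedrichs inequality on a box. -/
lemma exists_poincare {d : ℕ} (hd : 0 < d) (a b : Fin d → ℝ) :
    ∃ K : ℝ≥0∞, K ≠ ⊤ ∧ ∀ φ : 𝓓(openBox a b, ℝ),
      eLpNorm φ 2 (volume.restrict (openBox a b : Set (Space d))) ≤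
        K * eLpNorm (gradient φ) 2 (volume.restrict (openBox a b : Set (Space d))) := by
  -- Any coordinate direction would do, but one must exist: for `d = 0` a nonzero constant is a test
  -- function with zero gradient.
  obtain ⟨n, rfl⟩ : ∃ n, d = n + 1 := ⟨d - 1, by omega⟩
  refine ⟨_, ?_, fun φ => eLpNorm_le_of_sq_le (K := ENNReal.ofReal (b 0 - a 0) ^ 2) ?_⟩
  · finiteness
  · rw [← lintegral_gradient_test, eLpNorm_two_sq]
    exact (setLIntegral_le_lintegral _ _).trans (lintegral_test_le φ 0)

/-- The boundary of one of the two cells already suffices; this reduces the trace inequality to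
finitely many hyperplanes. -/
lemma BoxPartition.interface_subset {d : ℕ} {a b : Fin d → ℝ} (P : BoxPartition a b) :
    P.interface ⊆ ⋃ i : Fin P.card, ⋃ k : Fin d,
      ({x | x k = P.lower i k} ∪ {x | x k = P.upper i k}) := by
  rintro x ⟨-, i, j, -, hi, -⟩
  exact Set.mem_iUnion.2 ⟨i, frontier_openBox_subset _ _ hi⟩

/-- The trace inequality on the interfaces of a partition of a box. -/
lemma BoxPartition.exists_trace {d : ℕ} {a b : Fin d → ℝ} (P : BoxPartition a b) :
    ∃ K : ℝ≥0∞, K ≠ ⊤ ∧ ∀ φ : 𝓓(openBox a b, ℝ),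
      eLpNorm φ 2 P.surface ≤
        K * eLpNorm (gradient φ) 2 (volume.restrict (openBox a b : Set (Space d))) := by
  cases d with
  | zero =>
    refine ⟨0, by simp, fun φ => ?_⟩
    have h : P.surface = 0 := by
      rw [surface, Measure.restrict_eq_zero]
      exact measure_mono_null P.interface_subset (by simp)
    simp [h]
  | succ n =>
    -- Each cell has two faces orthogonal to each direction `k`, and each face hyperplane costs `b k
    -- - a k`. Overlaps are counted repeatedly, and each face is enlarged to its whole hyperplane.
    let M : ℝ≥0∞ := ∑ _i : Fin P.card, ∑ k : Fin (n + 1), 2 * ENNReal.ofReal (b k - a k)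
    have hM : M ≠ ⊤ := by
      refine ENNReal.sum_ne_top.2 fun i _ => ENNReal.sum_ne_top.2 fun k _ => ?_
      finiteness
    refine ⟨_, ?_, fun φ => eLpNorm_le_of_sq_le (K := M) ?_⟩
    · finiteness
    rw [← lintegral_gradient_test, eLpNorm_two_sq]
    have hF := measurable_enorm_sq_test φ
    have hk : ∀ (k : Fin (n + 1)) (c : ℝ),
        ∫⁻ x in {x | x k = c}, ‖φ x‖ₑ ^ 2 ∂(Measure.euclideanHausdorffMeasure n) ≤
          ENNReal.ofReal (b k - a k) * ∫⁻ x, ‖gradient φ x‖ₑ ^ 2 := fun k c => by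
      rw [lintegral_hyperplane k c hF]
      exact lintegral_sliceMap_test_le φ k c
    rw [surface, Nat.add_sub_cancel]
    refine (lintegral_mono_set P.interface_subset).trans ((lintegral_iUnion_le _ _).trans ?_)
    rw [tsum_fintype, Finset.sum_mul]
    refine Finset.sum_le_sum fun i _ => (lintegral_iUnion_le _ _).trans ?_
    rw [tsum_fintype, Finset.sum_mul]
    refine Finset.sum_le_sum fun k _ => (lintegral_union_le _ _ _).trans ?_
    rw [two_mul, add_mul]
    exact add_le_add (hk k _) (hk k _)

/-! ### Test functions as elements of `H¹₀` -/

section TestFunctions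

variable {d : ℕ} {U : Opens (Space d)}

lemma isWeakGrad_test (φ : 𝓓(U, ℝ)) :
    IsWeakGrad U ((memLp_test φ _).toLp φ) ((memLp_gradient φ _).toLp (gradient φ)) := by
  intro ψ k
  have e1 : ∀ (χ : 𝓓(U, ℝ)) x, (gradient χ x) k = fderiv ℝ χ x (EuclideanSpace.single k 1) := by
    intro χ x
    rw [fderiv_apply_eq_inner_gradient, EuclideanSpace.inner_single_right]
    simp
  have m := memLp_test φ (volume : Measure (Space d))
  have m' := memLp_test ψ (volume : Measure (Space d))
  have g := memLp_coord (memLp_gradient φ (volume : Measure (Space d))) k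
  have g' := memLp_coord (memLp_gradient ψ (volume : Measure (Space d))) k
  -- Integration by parts takes place on the whole space, where both functions are smooth with
  -- compact support; the boundary of `U` plays no role.
  have key : ∫ x, φ x * (gradient ψ x) k = -∫ x, (gradient φ x) k * ψ x := by
    simp_rw [e1]
    refine integral_mul_fderiv_eq_neg_fderiv_mul_of_integrable ?_ ?_ (integrable_mul m m')
      (fun x _ => differentiable_test φ x) (fun x _ => differentiable_test ψ x)
    · simpa only [e1] using integrable_mul g m'
    · simpa only [e1] using integrable_mul m g'
  have s1 : ∫ x in (U : Set (Space d)), φ x * (gradient ψ x) k = ∫ x, φ x * (gradient ψ x) k :=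
    setIntegral_eq_integral_of_forall_compl_eq_zero fun x hx => by
      rw [test_eq_zero φ hx, zero_mul]
  have s2 : ∫ x in (U : Set (Space d)), (gradient φ x) k * ψ x = ∫ x, (gradient φ x) k * ψ x :=
    setIntegral_eq_integral_of_forall_compl_eq_zero fun x hx => by
      rw [test_eq_zero ψ hx, mul_zero]
  rw [← s1, ← s2] at key
  convert key using 1
  · refine integral_congr_ae ?_
    filter_upwards [(memLp_test φ (volume.restrict (U : Set (Space d)))).coeFn_toLp] with x hx
    rw [hx]
  · congr 1
    refine integral_congr_ae ?_
    filter_upwards [(memLp_gradient φ (volume.restrict (U : Set (Space d)))).coeFn_toLp] with x hx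
    rw [hx]

lemma weakGrad_test (φ : 𝓓(U, ℝ)) :
    weakGrad U ((memLp_test φ _).toLp φ) = (memLp_gradient φ _).toLp (gradient φ) :=
  (isWeakGrad_test φ).weakGrad_eq

lemma test_mem_H10 (φ : 𝓓(U, ℝ)) : (memLp_test φ _).toLp φ ∈ H10 U := by
  refine ⟨⟨_, isWeakGrad_test φ⟩, fun _ => φ, ?_, ?_⟩
  · refine tendsto_const_nhds.congr fun n => ?_
    rw [← eLpNorm_zero (α := Space d) (ε := ℝ) (p := 2)
      (μ := volume.restrict (U : Set (Space d)))]
    refine (eLpNorm_congr_ae ?_).symm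
    filter_upwards [(memLp_test φ (volume.restrict (U : Set (Space d)))).coeFn_toLp] with x hx
    simp [hx]
  · refine tendsto_const_nhds.congr fun n => ?_
    rw [← eLpNorm_zero (α := Space d) (ε := Space d) (p := 2)
      (μ := volume.restrict (U : Set (Space d))), weakGrad_test]
    refine (eLpNorm_congr_ae ?_).symm
    filter_upwards [(memLp_gradient φ (volume.restrict (U : Set (Space d)))).coeFn_toLp] with x hx
    simp [hx]

lemma integral_mul_le {α : Type*} [MeasurableSpace α] {μ : Measure α} {f g : α → ℝ}
    (hf : MemLp f 2 μ) (hg : MemLp g 2 μ) :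
    |∫ x, f x * g x ∂μ| ≤ (eLpNorm f 2 μ).toReal * (eLpNorm g 2 μ).toReal := by
  have h := abs_real_inner_le_norm (hf.toLp f) (hg.toLp g)
  rw [Lp.norm_toLp, Lp.norm_toLp, MeasureTheory.L2.inner_def] at h
  refine le_trans (le_of_eq ?_) h
  congr 1
  refine integral_congr_ae ?_
  filter_upwards [hf.coeFn_toLp, hg.coeFn_toLp] with x h1 h2
  simp [h1, h2, mul_comm]

/-- The `H¹₀` seminorm is the limit of the seminorms of approximating test functions. -/
lemma tendsto_toLp_gradient {u : L2 U} {φ : ℕ → 𝓓(U, ℝ)}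
    (h : Tendsto (fun n => eLpNorm (fun x => gradient (φ n) x - weakGrad U u x) 2
      (volume.restrict (U : Set (Space d)))) atTop (𝓝 0)) :
    Tendsto (fun n => (memLp_gradient (φ n) (volume.restrict (U : Set (Space d)))).toLp _) atTop
      (𝓝 (weakGrad U u)) := by
  rw [Lp.tendsto_Lp_iff_tendsto_eLpNorm']
  refine h.congr fun n => eLpNorm_congr_ae ?_
  filter_upwards [(memLp_gradient (φ n) (volume.restrict (U : Set (Space d)))).coeFn_toLp]
    with x hx
  simp [hx]

end TestFunctions

/-- The approximating test functions have gradients tending to `0`, hence tend to `0` in `L²` by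
Poincaré, while also tending to `u`. This yields definiteness of both norms. -/
lemma eq_zero_of_weakGrad_eq_zero {d : ℕ} (hd : 0 < d) {a b : Fin d → ℝ} {u : L2 (openBox a b)}
    (hu : u ∈ H10 (openBox a b)) (h : weakGrad (openBox a b) u = 0) : u = 0 := by
  obtain ⟨K, hK, hP⟩ := exists_poincare hd a b
  obtain ⟨-, φ, h1, h2⟩ := hu
  have h3 : Tendsto (fun n => eLpNorm (gradient (φ n)) 2
      (volume.restrict (openBox a b : Set (Space d)))) atTop (𝓝 0) := by
    refine h2.congr fun n => eLpNorm_congr_ae ?_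
    filter_upwards [Lp.coeFn_zero (Space d) 2 (volume.restrict (openBox a b : Set (Space d)))]
      with x hx
    rw [h, hx, Pi.zero_apply, sub_zero]
  have h4 : ∀ n, eLpNorm u 2 (volume.restrict (openBox a b : Set (Space d))) ≤
      K * eLpNorm (gradient (φ n)) 2 (volume.restrict (openBox a b : Set (Space d))) +
        eLpNorm (fun x => φ n x - u x) 2 (volume.restrict (openBox a b : Set (Space d))) := by
    intro n
    have e : (u : Space d → ℝ) = (φ n : Space d → ℝ) - fun x => φ n x - u x := by
      ext x; simp
    calc eLpNorm u 2 (volume.restrict (openBox a b : Set (Space d)))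
        = eLpNorm ((φ n : Space d → ℝ) - fun x => φ n x - u x) 2
            (volume.restrict (openBox a b : Set (Space d))) := by rw [← e]
      _ ≤ _ := (eLpNorm_sub_le (memLp_test (φ n) _).1
          ((memLp_test (φ n) _).sub (Lp.memLp u)).1 (by norm_num)).trans
            (add_le_add_left (hP (φ n)) _)
  have h5 := (ENNReal.Tendsto.const_mul (a := K) h3 (Or.inr hK)).add h1
  rw [mul_zero, add_zero] at h5
  have h6 := le_antisymm (ge_of_tendsto' h5 h4) zero_le
  rw [eLpNorm_eq_zero_iff (Lp.memLp u).1 (by norm_num)] at h6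
  exact (Lp.eq_zero_iff_ae_eq_zero).2 h6

/-! ### Decomposition of integrals over the cells -/

lemma convex_openBox {d : ℕ} (a b : Fin d → ℝ) : Convex ℝ (openBox a b : Set (Space d)) := by
  intro x hx y hy s t hs ht hst k
  have := convex_Ioo (a k) (b k) (hx k) (hy k) hs ht hst
  simpa using this

lemma openBox_nonempty {d : ℕ} {a b : Fin d → ℝ} (hab : ∀ k, a k < b k) :
    (openBox a b : Set (Space d)).Nonempty := by
  refine ⟨WithLp.toLp 2 fun k => (a k + b k) / 2, fun k => ?_⟩
  have := hab k
  constructor <;> simp only <;> linarith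

namespace BoxPartition

variable {d : ℕ} {a b : Fin d → ℝ} (P : BoxPartition a b)

/-- The cells miss only points on their boundaries, and the boundary of a convex set is
Lebesgue-null. -/
lemma restrict_eq_sum :
    volume.restrict (openBox a b : Set (Space d)) =
      Measure.sum fun i => volume.restrict (P.cell i : Set (Space d)) := by
  rw [← Measure.restrict_iUnion (s := fun i => (P.cell i : Set (Space d)))
    (fun i j hij => P.disjoint i j hij) fun i => (P.cell i).isOpen.measurableSet]
  refine Measure.restrict_congr_set ?_
  refine (LE.le.eventuallyLE (Set.iUnion_subset P.subset)).antisymm ?_ |>.symm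
  rw [ae_le_set]
  refine measure_mono_null (t := ⋃ i, frontier (P.cell i : Set (Space d))) ?_ ?_
  · rintro x ⟨hx, hx'⟩
    have := subset_closure hx
    rw [P.cover, Set.mem_iUnion] at this
    obtain ⟨i, hi⟩ := this
    refine Set.mem_iUnion.2 ⟨i, hi, fun hc => hx' (Set.mem_iUnion.2 ⟨i, interior_subset hc⟩)⟩
  · exact measure_iUnion_null fun i => (convex_openBox _ _).addHaar_frontier _

lemma ae_iff_forall_cell {q : Space d → Prop} :
    (∀ᵐ x ∂(volume.restrict (openBox a b : Set (Space d))), q x) ↔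
      ∀ i, ∀ᵐ x ∂(volume.restrict (P.cell i : Set (Space d))), q x := by
  refine ⟨fun h i => ae_cell_of_ae i h, fun h => ?_⟩
  rw [P.restrict_eq_sum]
  exact Measure.ae_sum_iff.2 h

lemma integral_eq_sum {f : Space d → ℝ}
    (hf : Integrable f (volume.restrict (openBox a b : Set (Space d)))) :
    ∫ x in (openBox a b : Set (Space d)), f x =
      ∑ i, ∫ x in (P.cell i : Set (Space d)), f x := by
  rw [P.restrict_eq_sum] at hf ⊢
  rw [integral_sum_measure hf, tsum_fintype]

lemma eLpNorm_sq_eq_sum {f : Space d → ℝ} {F : ∀ i, L2 (P.cell i)}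
    (h : ∀ i, f =ᵐ[volume.restrict (P.cell i : Set (Space d))] F i) :
    eLpNorm f 2 (volume.restrict (openBox a b : Set (Space d))) ^ 2 =
      ∑ i, eLpNorm (F i) 2 (volume.restrict (P.cell i : Set (Space d))) ^ 2 := by
  rw [eLpNorm_two_sq, P.restrict_eq_sum, lintegral_sum_measure, tsum_fintype]
  refine Finset.sum_congr rfl fun i _ => ?_
  rw [eLpNorm_two_sq]
  refine lintegral_congr_ae ?_
  filter_upwards [h i] with x hx
  rw [hx]

lemma memLp_of_cells {f : Space d → ℝ} {F : ∀ i, L2 (P.cell i)}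
    (h : ∀ i, f =ᵐ[volume.restrict (P.cell i : Set (Space d))] F i) :
    MemLp f 2 (volume.restrict (openBox a b : Set (Space d))) := by
  refine ⟨?_, ?_⟩
  · rw [P.restrict_eq_sum, aestronglyMeasurable_sum_measure_iff]
    exact fun i => (Lp.memLp (F i)).1.congr (h i).symm
  · have : eLpNorm f 2 (volume.restrict (openBox a b : Set (Space d))) ^ 2 < ⊤ := by
      rw [P.eLpNorm_sq_eq_sum h]
      exact ENNReal.sum_lt_top.2 fun i _ => ENNReal.pow_lt_top (Lp.memLp (F i)).2
    exact (ENNReal.pow_lt_top_iff.1 this).resolve_right (by norm_num)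

lemma lpNorm_sq_eq_sum {f : Space d → ℝ} {F : ∀ i, L2 (P.cell i)}
    (h : ∀ i, f =ᵐ[volume.restrict (P.cell i : Set (Space d))] F i) :
    lpNorm f 2 (volume.restrict (openBox a b : Set (Space d))) ^ 2 = ∑ i, ‖F i‖ ^ 2 := by
  rw [← toReal_eLpNorm (P.memLp_of_cells h).1, ← ENNReal.toReal_pow, P.eLpNorm_sq_eq_sum h,
    ENNReal.toReal_sum fun i _ => ENNReal.pow_ne_top (Lp.memLp (F i)).2.ne]
  simp only [ENNReal.toReal_pow, Lp.norm_def]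

lemma sum_indicator_cell {E : Type*} [AddCommMonoid E] (F : Fin P.card → Space d → E)
    {i : Fin P.card} {x : Space d} (hx : x ∈ P.cell i) :
    ∑ j, (P.cell j : Set (Space d)).indicator (F j) x = F i x := by
  rw [Finset.sum_eq_single i, Set.indicator_of_mem hx]
  · intro j _ hj
    exact Set.indicator_of_notMem (fun h => Set.disjoint_left.1 (P.disjoint j i hj) h hx) _
  · simp

lemma coeff_eq (p : Fin P.card → ℝ) {i : Fin P.card} {x : Space d} (hx : x ∈ P.cell i) :
    P.coeff p x = p i :=
  P.sum_indicator_cell (fun i _ => p i) hx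

lemma divFlux_ae_eq (p : Fin P.card → ℝ) (u : L2 (openBox a b)) (i : Fin P.card) :
    P.divFlux p u =ᵐ[volume.restrict (P.cell i : Set (Space d))]
      weakDiv (P.cell i) (P.flux p u) := by
  filter_upwards [ae_restrict_mem (P.cell i).isOpen.measurableSet] with x hx
  exact P.sum_indicator_cell (fun i => ⇑(weakDiv (P.cell i) (P.flux p u))) hx

lemma memLp_divFlux (p : Fin P.card → ℝ) (u : L2 (openBox a b)) :
    MemLp (P.divFlux p u) 2 (volume.restrict (openBox a b : Set (Space d))) :=
  P.memLp_of_cells (P.divFlux_ae_eq p u)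

lemma measurable_coeff (p : Fin P.card → ℝ) : Measurable (P.coeff p) := by
  unfold coeff
  exact Finset.measurable_fun_sum _ fun i _ =>
    measurable_const.indicator (P.cell i).isOpen.measurableSet

lemma abs_coeff_le (p : Fin P.card → ℝ) (x : Space d) : |P.coeff p x| ≤ ∑ i, |p i| := by
  refine (Finset.abs_sum_le_sum_abs _ _).trans (Finset.sum_le_sum fun i _ => ?_)
  by_cases hx : x ∈ (P.cell i : Set (Space d))
  · rw [Set.indicator_of_mem hx]
  · rw [Set.indicator_of_notMem hx, abs_zero]
    exact abs_nonneg _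

lemma memLp_flux (p : Fin P.card → ℝ) (u : L2 (openBox a b)) :
    MemLp (P.flux p u) 2 (volume.restrict (openBox a b : Set (Space d))) := by
  refine (Lp.memLp (weakGrad (openBox a b) u)).of_le_mul (c := ∑ i, |p i|)
    ((P.measurable_coeff p).aestronglyMeasurable.smul (Lp.memLp _).1) (ae_of_all _ fun x => ?_)
  rw [flux, norm_smul, Real.norm_eq_abs]
  exact mul_le_mul_of_nonneg_right (P.abs_coeff_le p x) (norm_nonneg _)

lemma memLp_flux_cell (p : Fin P.card → ℝ) (u : L2 (openBox a b)) (i : Fin P.card) :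
    MemLp (P.flux p u) 2 (volume.restrict (P.cell i : Set (Space d))) :=
  (P.memLp_flux p u).mono_measure (Measure.restrict_mono (P.subset i) le_rfl)

/-- The cellwise integrals glue to integrals over `Ω`. Combined with the definition of the jump this
is Green's identity, valid for `φ` that need not vanish on `Γ`. -/
lemma sum_normalTrace (p : Fin P.card → ℝ) (u : L2 (openBox a b)) (φ : 𝓓(openBox a b, ℝ)) :
    ∑ i, normalTrace (P.cell i) (P.flux p u) φ =
      (∫ x in (openBox a b : Set (Space d)), inner ℝ (P.flux p u x) (gradient φ x)) +
        ∫ x in (openBox a b : Set (Space d)), P.divFlux p u x * φ x := by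
  have i1 := integrable_inner' (P.memLp_flux p u) (memLp_gradient φ _)
  have i2 := integrable_mul (P.memLp_divFlux p u) (memLp_test φ _)
  refine Eq.trans ?_ ((P.integral_eq_sum (i1.add i2)).symm.trans (integral_add i1 i2))
  refine Finset.sum_congr rfl fun i _ => integral_congr_ae ?_
  filter_upwards [P.divFlux_ae_eq p u i] with x hx
  rw [Pi.add_apply, hx]

/-! ### The jump -/

/-- The fundamental lemma of the calculus of variations for the surface measure: this measure is
finite and is carried by `Γ ⊆ Ω`, so test functions on `Ω` separate `L²(Γ)`. -/
lemma IsJump.unique {P : BoxPartition a b} {σ : Space d → Space d} {g g' : Lp ℝ 2 P.surface}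
    (h : P.IsJump σ g) (h' : P.IsJump σ g') : g = g' := by
  rw [← sub_eq_zero, Lp.eq_zero_iff_ae_eq_zero]
  have hl : LocallyIntegrable (⇑(g - g')) P.surface :=
    (Lp.memLp (g - g')).locallyIntegrable (by norm_num)
  have key := (openBox a b).isOpen.ae_eq_zero_of_integral_contDiff_smul_eq_zero
    (hl.locallyIntegrableOn _) (by
      intro φ hφ hc hs
      let ψ : 𝓓(openBox a b, ℝ) := ⟨φ, hφ, hc, hs⟩
      have m := memLp_test ψ P.surface
      have e : ∫ x, (g x * ψ x - g' x * ψ x) ∂P.surface = 0 := by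
        rw [integral_sub (integrable_mul (Lp.memLp g) m) (integrable_mul (Lp.memLp g') m), ← h ψ,
          ← h' ψ, sub_self]
      rw [← e]
      refine integral_congr_ae ?_
      filter_upwards [Lp.coeFn_sub g g'] with x hx
      rw [hx, Pi.sub_apply, smul_eq_mul, mul_comm, sub_mul]
      rfl)
  have hm : ∀ᵐ x ∂P.surface, x ∈ (openBox a b : Set (Space d)) := by
    exact ae_mono (Measure.restrict_mono Set.inter_subset_left le_rfl)
      (ae_restrict_mem (openBox a b).isOpen.measurableSet)
  filter_upwards [key, hm] with x h1 h2 using h1 h2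

lemma IsJump.jump_eq {P : BoxPartition a b} {σ : Space d → Space d} {g : Lp ℝ 2 P.surface}
    (h : P.IsJump σ g) : P.jump σ = g := by
  have h' : ∃ g, P.IsJump σ g := ⟨g, h⟩
  rw [jump, dif_pos h']
  exact h'.choose_spec.unique h

lemma isJump_jumpFlux {P : BoxPartition a b} {p : Fin P.card → ℝ} {u : L2 (openBox a b)}
    (hu : u ∈ P.Xp p) : P.IsJump (P.flux p u) (P.jumpFlux p u) := by
  obtain ⟨-, -, g, hg⟩ := hu
  rwa [jumpFlux, hg.jump_eq]

end BoxPartition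

/-- Realizing a root of a sum of squares as a Hilbert norm of a linear map replaces a direct proof
of Minkowski's inequality. -/
lemma isNorm_norm_comp {V E : Type*} [AddCommGroup V] [Module ℝ V] [NormedAddCommGroup E]
    [NormedSpace ℝ E] (T : V →ₗ[ℝ] E) (hT : ∀ u, ‖T u‖ = 0 → u = 0) :
    IsNorm fun u => ‖T u‖ := by
  refine ⟨fun u v => ?_, fun c u => ?_, hT⟩
  · simp only [map_add]
    exact norm_add_le _ _
  · simp only [map_smul, norm_smul, Real.norm_eq_abs]

namespace BoxPartition

variable {d : ℕ} {a b : Fin d → ℝ} (P : BoxPartition a b)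

/-! ### Linearity of gradient, divergence and jump on `𝕏ᵖ` -/

section Linear

variable {P} {p : Fin P.card → ℝ}

lemma IsJump.add {σ τ : Space d → Space d} {g g' : Lp ℝ 2 P.surface}
    (hσ : ∀ i, MemHdiv (P.cell i) σ) (hτ : ∀ i, MemHdiv (P.cell i) τ)
    (h : P.IsJump σ g) (h' : P.IsJump τ g') : P.IsJump (σ + τ) (g + g') := by
  intro φ
  have m := memLp_test φ P.surface
  simp_rw [normalTrace_add (hσ _) (hτ _)]
  rw [Finset.sum_add_distrib, h φ, h' φ, ← integral_add
    (integrable_mul (Lp.memLp g) m) (integrable_mul (Lp.memLp g') m)]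
  refine integral_congr_ae ?_
  filter_upwards [Lp.coeFn_add g g'] with x hx
  rw [hx, Pi.add_apply, add_mul]

lemma IsJump.smul (c : ℝ) {σ : Space d → Space d} {g : Lp ℝ 2 P.surface}
    (hσ : ∀ i, MemHdiv (P.cell i) σ) (h : P.IsJump σ g) : P.IsJump (c • σ) (c • g) := by
  intro φ
  simp_rw [normalTrace_smul c (hσ _)]
  rw [← Finset.mul_sum, h φ, ← integral_const_mul]
  refine integral_congr_ae ?_
  filter_upwards [Lp.coeFn_smul c g] with x hx
  rw [hx, Pi.smul_apply, smul_eq_mul, mul_assoc]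

lemma IsJump.congr {σ τ : Space d → Space d} {g : Lp ℝ 2 P.surface}
    (hσ : ∀ i, MemHdiv (P.cell i) σ) (h : P.IsJump σ g)
    (e : σ =ᵐ[volume.restrict (openBox a b : Set (Space d))] τ) : P.IsJump τ g := by
  intro φ
  rw [← h φ]
  exact Finset.sum_congr rfl fun i _ => (normalTrace_congr (hσ i) (ae_cell_of_ae i e) φ).symm

variable (P p) in
/-- The gradient as a linear map on `𝕏ᵖ`. -/
def gradMap : P.Xp p →ₗ[ℝ] L2Vec (openBox a b) where
  toFun u := weakGrad (openBox a b) u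
  map_add' u v := ((weakGrad_spec u.2.1.1).add (weakGrad_spec v.2.1.1)).weakGrad_eq
  map_smul' c u := ((weakGrad_spec u.2.1.1).smul c).weakGrad_eq

variable (P p) in
/-- The divergence of the flux on a cell as a linear map on `𝕏ᵖ`. -/
def divMap (i : Fin P.card) : P.Xp p →ₗ[ℝ] L2 (P.cell i) where
  toFun u := weakDiv (P.cell i) (P.flux p u)
  map_add' u v := (((u.2.2.1 i).isWeakDiv.add (u.2.2.1 i).1 (v.2.2.1 i).1
    (v.2.2.1 i).isWeakDiv).congr (ae_cell_of_ae i (P.flux_add p u.2.1 v.2.1))).weakDiv_eq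
  map_smul' c u := (((u.2.2.1 i).isWeakDiv.smul c).congr
    (ae_cell_of_ae i (P.flux_smul p c u.2.1))).weakDiv_eq

variable (P p) in
/-- The jump of the flux as a linear map on `𝕏ᵖ`. -/
def jumpMap : P.Xp p →ₗ[ℝ] Lp ℝ 2 P.surface where
  toFun u := P.jumpFlux p u
  map_add' u v := (((isJump_jumpFlux u.2).add u.2.2.1 v.2.2.1 (isJump_jumpFlux v.2)).congr
    (fun i => (u.2.2.1 i).add (v.2.2.1 i)) (P.flux_add p u.2.1 v.2.1)).jump_eq
  map_smul' c u := (((isJump_jumpFlux u.2).smul c u.2.2.1).congr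
    (fun i => (u.2.2.1 i).smul c) (P.flux_smul p c u.2.1)).jump_eq

variable (P p) in
/-- The residuals as a linear map into a Hilbert space. -/
def resMap (Θ : ℝ) : P.Xp p →ₗ[ℝ]
    WithLp 2 (PiLp 2 (fun i => L2 (P.cell i)) × Lp ℝ 2 P.surface) :=
  (WithLp.linearEquiv 2 ℝ _).symm.toLinearMap ∘ₗ
    ((WithLp.linearEquiv 2 ℝ _).symm.toLinearMap ∘ₗ LinearMap.pi (P.divMap p)).prod
      -- The factor `√Θ` becomes the weight `Θ` after squaring.
      (√Θ • P.jumpMap p)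

variable (P p) in
/-- The gradient and the residuals as a linear map into a Hilbert space. -/
def graphMap : P.Xp p →ₗ[ℝ] WithLp 2 (L2Vec (openBox a b) ×
    WithLp 2 (PiLp 2 (fun i => L2 (P.cell i)) × Lp ℝ 2 P.surface)) :=
  (WithLp.linearEquiv 2 ℝ _).symm.toLinearMap ∘ₗ (P.gradMap p).prod (P.resMap p 1)

lemma norm_resMap_sq {Θ : ℝ} (hΘ : 0 ≤ Θ) (u : P.Xp p) :
    ‖P.resMap p Θ u‖ ^ 2 =
      ∑ i, ‖weakDiv (P.cell i) (P.flux p u)‖ ^ 2 + Θ * ‖P.jumpFlux p u‖ ^ 2 := by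
  rw [WithLp.prod_norm_sq_eq_of_L2, PiLp.norm_sq_eq_of_L2]
  congr 1
  change ‖√Θ • P.jumpFlux p u‖ ^ 2 = _
  rw [norm_smul, mul_pow, Real.norm_eq_abs, sq_abs, Real.sq_sqrt hΘ]

lemma resNorm_eq_norm {Θ : ℝ} (hΘ : 0 ≤ Θ) (u : P.Xp p) :
    P.resNorm p Θ u = ‖P.resMap p Θ u‖ := by
  rw [resNorm, P.lpNorm_sq_eq_sum (P.divFlux_ae_eq p u), ← norm_resMap_sq hΘ,
    Real.sqrt_sq (norm_nonneg _)]

lemma graphNorm_eq_norm (u : P.Xp p) : P.graphNorm p u = ‖P.graphMap p u‖ := by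
  have h : ‖P.graphMap p u‖ ^ 2 = P.normH10 u ^ 2 + ‖P.resMap p 1 u‖ ^ 2 :=
    WithLp.prod_norm_sq_eq_of_L2 _
  rw [norm_resMap_sq zero_le_one, one_mul, ← add_assoc] at h
  rw [graphNorm, ← h, Real.sqrt_sq (norm_nonneg _)]

lemma graphNorm_sq (u : L2 (openBox a b)) :
    P.graphNorm p u ^ 2 = P.normH10 u ^ 2 + ∑ i, ‖weakDiv (P.cell i) (P.flux p u)‖ ^ 2 +
      ‖P.jumpFlux p u‖ ^ 2 :=
  Real.sq_sqrt (by positivity)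

lemma resNorm_sq {Θ : ℝ} (hΘ : 0 ≤ Θ) (u : L2 (openBox a b)) :
    P.resNorm p Θ u ^ 2 = ∑ i, ‖weakDiv (P.cell i) (P.flux p u)‖ ^ 2 +
      Θ * ‖P.jumpFlux p u‖ ^ 2 := by
  rw [resNorm, P.lpNorm_sq_eq_sum (P.divFlux_ae_eq p u)]
  exact Real.sq_sqrt (by positivity)

end Linear

/-! ### The a posteriori estimate -/

/-- Needed for `⨅ i, p i` to be a genuine minimum; over an empty index set it would take the default
value `0`. -/
lemma nonempty_fin_card (hab : ∀ k, a k < b k) : Nonempty (Fin P.card) := by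
  obtain ⟨x, hx⟩ := openBox_nonempty hab
  have := subset_closure hx
  rw [P.cover, Set.mem_iUnion] at this
  exact ⟨this.choose⟩

variable {P} in
lemma iInf_pos (hab : ∀ k, a k < b k) {p : Fin P.card → ℝ} (hp : ∀ i, 0 < p i) :
    0 < ⨅ i, p i := by
  have := P.nonempty_fin_card hab
  obtain ⟨i, hi⟩ := exists_eq_ciInf_of_finite (f := p)
  rw [← hi]
  exact hp i

/-- The flux functional on test functions is bounded by the residuals. -/
lemma abs_integral_flux_le {p : Fin P.card → ℝ} {u : L2 (openBox a b)} (hu : u ∈ P.Xp p)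
    {K K' : ℝ≥0∞} (hK : K ≠ ⊤) (hK' : K' ≠ ⊤) (φ : 𝓓(openBox a b, ℝ))
    (h : eLpNorm φ 2 (volume.restrict (openBox a b : Set (Space d))) ≤
        K * eLpNorm (gradient φ) 2 (volume.restrict (openBox a b : Set (Space d))))
    (h' : eLpNorm φ 2 P.surface ≤
        K' * eLpNorm (gradient φ) 2 (volume.restrict (openBox a b : Set (Space d)))) :
    |∫ x in (openBox a b : Set (Space d)), inner ℝ (P.flux p u x) (gradient φ x)| ≤
      (K.toReal * lpNorm (P.divFlux p u) 2 (volume.restrict (openBox a b : Set (Space d))) +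
        K'.toReal * ‖P.jumpFlux p u‖) *
      (eLpNorm (gradient φ) 2 (volume.restrict (openBox a b : Set (Space d)))).toReal := by
  have hg := (memLp_gradient φ (volume.restrict (openBox a b : Set (Space d)))).2.ne
  have r := ENNReal.toReal_mono (ENNReal.mul_ne_top hK hg) h
  have r' := ENNReal.toReal_mono (ENNReal.mul_ne_top hK' hg) h'
  rw [ENNReal.toReal_mul] at r r'
  have e1 := isJump_jumpFlux hu φ
  rw [P.sum_normalTrace] at e1
  have b1 := integral_mul_le (P.memLp_divFlux p u) (memLp_test φ _)
  have b2 := integral_mul_le (Lp.memLp (P.jumpFlux p u)) (memLp_test φ P.surface)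
  rw [toReal_eLpNorm (P.memLp_divFlux p u).1] at b1
  rw [← Lp.norm_def] at b2
  -- Green's identity, solved for the flux integral.
  rw [eq_sub_of_add_eq e1]
  refine (abs_sub _ _).trans ?_
  have b3 := b1.trans (mul_le_mul_of_nonneg_left r lpNorm_nonneg)
  have b4 := b2.trans (mul_le_mul_of_nonneg_left r' (norm_nonneg _))
  linarith

/-- The residuals control the energy. -/
lemma mul_normH10_le {p : Fin P.card → ℝ} {u : L2 (openBox a b)} (hu : u ∈ P.Xp p)
    {m : ℝ} (hm : ∀ i, m ≤ p i) {A : ℝ}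
    (h : ∀ φ : 𝓓(openBox a b, ℝ),
      |∫ x in (openBox a b : Set (Space d)), inner ℝ (P.flux p u x) (gradient φ x)| ≤
      A * (eLpNorm (gradient φ) 2 (volume.restrict (openBox a b : Set (Space d)))).toReal)
    (hA : 0 ≤ A) : m * P.normH10 u ≤ A := by
  set G := weakGrad (openBox a b) u
  let σ := (P.memLp_flux p u).toLp _
  obtain ⟨-, φ, -, hφ⟩ := hu.1
  have hlim := tendsto_toLp_gradient hφ
  -- Both sides are continuous in the gradient, so the bound passes from the test functions to `u`
  -- itself.
  have h1 : inner ℝ σ G ≤ A * ‖G‖ := by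
    refine le_of_tendsto_of_tendsto' (tendsto_const_nhds.inner hlim)
      (hlim.norm.const_mul A) fun n => ?_
    rw [Lp.norm_toLp]
    refine le_trans (le_of_eq ?_) ((le_abs_self _).trans (h (φ n)))
    rw [MeasureTheory.L2.inner_def]
    refine integral_congr_ae ?_
    filter_upwards [(P.memLp_flux p u).coeFn_toLp, (memLp_gradient (φ n)
      (volume.restrict (openBox a b : Set (Space d)))).coeFn_toLp] with x h1 h2
    rw [h1, h2]
  -- Coercivity: `P.coeff p` equals some `p i ≥ m` off a null set. Its value `0` on `Γ` is invisible
  -- to Lebesgue measure.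
  have h2 : m * ‖G‖ ^ 2 ≤ inner ℝ σ G := by
    rw [← real_inner_self_eq_norm_sq, MeasureTheory.L2.inner_def, MeasureTheory.L2.inner_def,
      ← integral_const_mul]
    refine integral_mono_ae ((L2.integrable_inner G G).const_mul m) (L2.integrable_inner σ G) ?_
    have hc : ∀ᵐ x ∂(volume.restrict (openBox a b : Set (Space d))), m ≤ P.coeff p x := by
      refine P.ae_iff_forall_cell.2 fun i => ?_
      filter_upwards [ae_restrict_mem (P.cell i).isOpen.measurableSet] with x hx
      rw [P.coeff_eq p hx]
      exact hm i
    filter_upwards [hc, (P.memLp_flux p u).coeFn_toLp] with x h1 h2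
    simp only [σ]
    rw [h2, flux, real_inner_smul_left]
    exact mul_le_mul_of_nonneg_right h1 real_inner_self_nonneg
  change m * ‖G‖ ≤ A
  rcases (norm_nonneg G).eq_or_lt with h0 | h0
  · rw [← h0, mul_zero]
    exact hA
  · refine le_of_mul_le_mul_right ?_ h0
    linarith

/-- The residual norm controls the `H¹₀` norm, with a constant that depends on the partition
only through its set of interfaces. -/
lemma exists_normH10_le (hd : 0 < d) (hab : ∀ k, a k < b k) (Γ : Set (Space d)) {Θ : ℝ}
    (hΘ : 0 < Θ) :
    ∃ C : ℝ, 0 < C ∧ ∀ P : BoxPartition a b, P.interface = Γ → ∀ p : Fin P.card → ℝ,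
      (∀ i, 0 < p i) → ∀ u ∈ P.Xp p, P.normH10 u ≤ C / (⨅ i, p i) * P.resNorm p Θ u := by
  by_cases hP : ∃ P : BoxPartition a b, P.interface = Γ
  swap
  · exact ⟨1, one_pos, fun P h => absurd ⟨P, h⟩ hP⟩
  obtain ⟨P₀, rfl⟩ := hP
  obtain ⟨K, hK, hpoin⟩ := exists_poincare hd a b
  -- The trace constant comes from one chosen partition `P₀`, but the inequality involves the
  -- partition only through its surface measure, hence only through `Γ`; so it serves every `P` with
  -- the same interfaces.
  obtain ⟨K', hK', htrace⟩ := P₀.exists_trace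
  -- The residual norm dominates `√Θ` times the jump norm, hence the division by `√Θ`; the summand
  -- `1` only ensures positivity.
  refine ⟨K.toReal + K'.toReal / √Θ + 1, by positivity, fun P hP p hp u hu => ?_⟩
  have hs : P.surface = P₀.surface := by rw [surface, surface, hP]
  rw [← hs] at htrace
  have hm := iInf_pos hab hp
  have key := P.mul_normH10_le hu (fun i => ciInf_le (Set.finite_range p).bddBelow i)
    (fun φ => P.abs_integral_flux_le hu hK hK' φ (hpoin φ) (htrace φ))
    (by have := lpNorm_nonneg (f := P.divFlux p u) (p := 2)
          (μ := volume.restrict (openBox a b : Set (Space d)))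
        positivity)
  have hsq : 0 < √Θ := Real.sqrt_pos.2 hΘ
  have r1 : lpNorm (P.divFlux p u) 2 (volume.restrict (openBox a b : Set (Space d))) ≤
      P.resNorm p Θ u :=
    Real.le_sqrt_of_sq_le (le_add_of_nonneg_right (by positivity))
  have r2 : √Θ * ‖P.jumpFlux p u‖ ≤ P.resNorm p Θ u := by
    refine Real.le_sqrt_of_sq_le ?_
    rw [mul_pow, Real.sq_sqrt hΘ.le]
    exact le_add_of_nonneg_left (by positivity)
  have r3 : 0 ≤ P.resNorm p Θ u := Real.sqrt_nonneg _
  have r4 : K'.toReal * ‖P.jumpFlux p u‖ = K'.toReal / √Θ * (√Θ * ‖P.jumpFlux p u‖) := by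
    field_simp
  rw [div_mul_eq_mul_div, le_div_iff₀ hm, mul_comm]
  refine key.trans ?_
  rw [r4]
  have r5 := mul_le_mul_of_nonneg_left r1 (ENNReal.toReal_nonneg (a := K))
  have r6 := mul_le_mul_of_nonneg_left r2
    (div_nonneg (ENNReal.toReal_nonneg (a := K')) hsq.le)
  linarith

/-! ### Equivalence of the graph norm and the residual norm -/

variable {P} in
lemma exists_graphNorm_equiv_resNorm {p : Fin P.card → ℝ} {Θ K : ℝ} (hΘ : 0 < Θ)
    (h : ∀ u ∈ P.Xp p, P.normH10 u ≤ K * P.resNorm p Θ u) :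
    ∃ c₁ c₂ : ℝ, 0 < c₁ ∧ 0 < c₂ ∧ ∀ u ∈ P.Xp p,
      c₁ * P.graphNorm p u ≤ P.resNorm p Θ u ∧ P.resNorm p Θ u ≤ c₂ * P.graphNorm p u := by
  -- In terms of the squared residual norm, the gradient costs `K ^ 2`, the divergences `1` and the
  -- jump `Θ⁻¹`. Conversely `1 + Θ` dominates both weights `1` and `Θ`.
  have hM : 0 < K ^ 2 + 1 + Θ⁻¹ := by positivity
  refine ⟨(√(K ^ 2 + 1 + Θ⁻¹))⁻¹, √(1 + Θ), by positivity, by positivity, fun u hu => ?_⟩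
  have hg := P.graphNorm_sq (p := p) u
  have hr := P.resNorm_sq (p := p) hΘ.le u
  have g0 : 0 ≤ P.graphNorm p u := Real.sqrt_nonneg _
  have r0 : 0 ≤ P.resNorm p Θ u := Real.sqrt_nonneg _
  have s0 : 0 ≤ ∑ i, ‖weakDiv (P.cell i) (P.flux p u)‖ ^ 2 := by positivity
  have j0 : 0 ≤ ‖P.jumpFlux p u‖ ^ 2 := by positivity
  have h1 : P.normH10 u ^ 2 ≤ K ^ 2 * P.resNorm p Θ u ^ 2 := by
    rw [← mul_pow]
    exact pow_le_pow_left₀ (norm_nonneg _) (h u hu) 2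
  have h2 : ∑ i, ‖weakDiv (P.cell i) (P.flux p u)‖ ^ 2 ≤ P.resNorm p Θ u ^ 2 := by
    rw [hr]
    exact le_add_of_nonneg_right (by positivity)
  have h3 : ‖P.jumpFlux p u‖ ^ 2 ≤ Θ⁻¹ * P.resNorm p Θ u ^ 2 := by
    rw [le_inv_mul_iff₀ hΘ, hr]
    exact le_add_of_nonneg_left s0
  constructor
  · rw [inv_mul_le_iff₀ (Real.sqrt_pos.2 hM)]
    refine (pow_le_pow_iff_left₀ (by positivity) (by positivity) two_ne_zero).1 ?_
    rw [mul_pow, Real.sq_sqrt hM.le, hg]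
    linarith
  · refine (pow_le_pow_iff_left₀ (by positivity) (by positivity) two_ne_zero).1 ?_
    rw [mul_pow, Real.sq_sqrt (by positivity), hg, hr]
    nlinarith [sq_nonneg (P.normH10 u), mul_nonneg hΘ.le s0,
      mul_nonneg hΘ.le (sq_nonneg (P.normH10 u))]

/-! ### The transmission problem -/

/-- The restriction of an `L²` function to a cell. -/
def restrictCell (ℓ : L2 (openBox a b)) (i : Fin P.card) : L2 (P.cell i) :=
  ((Lp.memLp ℓ).mono_measure (Measure.restrict_mono (P.subset i) le_rfl)).toLp ℓ

lemma coeFn_restrictCell (ℓ : L2 (openBox a b)) (i : Fin P.card) :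
    P.restrictCell ℓ i =ᵐ[volume.restrict (P.cell i : Set (Space d))] ℓ :=
  MemLp.coeFn_toLp _

variable {P}

lemma IsWeakSolution.integral_test {p : Fin P.card → ℝ} {ℓ w : L2 (openBox a b)}
    (h : P.IsWeakSolution p ℓ w) (φ : 𝓓(openBox a b, ℝ)) :
    ∫ x in (openBox a b : Set (Space d)), inner ℝ (P.flux p w x) (gradient φ x) =
      ∫ x in (openBox a b : Set (Space d)), ℓ x * φ x := by
  have := h.2 _ (test_mem_H10 φ)
  rw [weakGrad_test] at this
  convert this using 1
  · refine integral_congr_ae ?_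
    filter_upwards [(memLp_gradient φ
      (volume.restrict (openBox a b : Set (Space d)))).coeFn_toLp] with x hx
    rw [hx]
  · refine integral_congr_ae ?_
    filter_upwards [(memLp_test φ
      (volume.restrict (openBox a b : Set (Space d)))).coeFn_toLp] with x hx
    rw [hx]

/-- A test function on the cell, extended by zero, is one on `Ω`, so the weak formulation can be
tested with it. -/
lemma IsWeakSolution.isWeakDiv {p : Fin P.card → ℝ} {ℓ w : L2 (openBox a b)}
    (h : P.IsWeakSolution p ℓ w) (i : Fin P.card) :
    IsWeakDiv (P.cell i) (P.flux p w) (-P.restrictCell ℓ i) := by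
  intro φ
  let ψ : 𝓓(openBox a b, ℝ) := ⟨φ, φ.contDiff, φ.hasCompactSupport,
    φ.tsupport_subset.trans (P.subset i)⟩
  have e := h.integral_test ψ
  have e1 : ∫ x in (openBox a b : Set (Space d)), inner ℝ (P.flux p w x) (gradient φ x) =
      ∫ x in (P.cell i : Set (Space d)), inner ℝ (P.flux p w x) (gradient φ x) :=
    setIntegral_eq_of_subset_of_forall_sdiff_eq_zero (openBox a b).isOpen.measurableSet
      (P.subset i) fun x hx => by rw [gradient_test_eq_zero φ hx.2, inner_zero_right]
  have e2 : ∫ x in (openBox a b : Set (Space d)), ℓ x * φ x =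
      ∫ x in (P.cell i : Set (Space d)), ℓ x * φ x :=
    setIntegral_eq_of_subset_of_forall_sdiff_eq_zero (openBox a b).isOpen.measurableSet
      (P.subset i) fun x hx => by rw [test_eq_zero φ hx.2, mul_zero]
  rw [← e1, ← integral_neg]
  refine (e.trans e2).trans (integral_congr_ae ?_)
  filter_upwards [Lp.coeFn_neg (P.restrictCell ℓ i), P.coeFn_restrictCell ℓ i] with x h1 h2
  rw [h1, Pi.neg_apply, h2, neg_mul, neg_neg]

/-- With divergence `-ℓ` on each cell, the two terms of Green's identity are `∫ ℓ φ` and `-∫ ℓ φ`,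
and they cancel. -/
lemma IsWeakSolution.isJump {p : Fin P.card → ℝ} {ℓ w : L2 (openBox a b)}
    (h : P.IsWeakSolution p ℓ w) : P.IsJump (P.flux p w) 0 := by
  intro φ
  have hz : ∫ x, (0 : Lp ℝ 2 P.surface) x * φ x ∂P.surface = 0 := by
    refine integral_eq_zero_of_ae ?_
    filter_upwards [Lp.coeFn_zero ℝ 2 P.surface] with x hx
    rw [hx]; simp
  rw [hz, P.sum_normalTrace, h.integral_test φ, ← integral_add
    (integrable_mul (Lp.memLp ℓ) (memLp_test φ _))
    (integrable_mul (P.memLp_divFlux p w) (memLp_test φ _))]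
  refine integral_eq_zero_of_ae (P.ae_iff_forall_cell.2 fun i => ?_)
  filter_upwards [P.divFlux_ae_eq p w i, Lp.coeFn_neg (P.restrictCell ℓ i),
    P.coeFn_restrictCell ℓ i] with x h1 h2 h3
  rw [h1, (h.isWeakDiv i).weakDiv_eq, h2, Pi.neg_apply, h3, neg_mul, add_neg_cancel]
  rfl

lemma IsWeakSolution.mem_Xp {p : Fin P.card → ℝ} {ℓ w : L2 (openBox a b)}
    (h : P.IsWeakSolution p ℓ w) : w ∈ P.Xp p :=
  ⟨h.1, fun i => ⟨P.memLp_flux_cell p w i, _, h.isWeakDiv i⟩, 0, h.isJump⟩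

/-- The residual norm of the error is the norm of the computable residuals. -/
lemma IsWeakSolution.resNorm_sub {p : Fin P.card → ℝ} {ℓ w : L2 (openBox a b)}
    (h : P.IsWeakSolution p ℓ w) {u : L2 (openBox a b)} (hu : u ∈ P.Xp p) (Θ : ℝ) :
    P.resNorm p Θ (u - w) =
      √((lpNorm (fun x => P.divFlux p u x + ℓ x) 2
          (volume.restrict (openBox a b : Set (Space d)))) ^ 2
        + Θ * ‖P.jumpFlux p u‖ ^ 2) := by
  have hj : P.jumpFlux p (u - w) = P.jumpFlux p u := by
    have := (P.jumpMap p).map_sub ⟨u, hu⟩ ⟨w, h.mem_Xp⟩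
    change P.jumpFlux p (u - w) = P.jumpFlux p u - P.jumpFlux p w at this
    rw [this, show P.jumpFlux p w = 0 from h.isJump.jump_eq, sub_zero]
  have hd : ∀ i, weakDiv (P.cell i) (P.flux p (u - w)) =
      weakDiv (P.cell i) (P.flux p u) + P.restrictCell ℓ i := fun i => by
    have := (P.divMap p i).map_sub ⟨u, hu⟩ ⟨w, h.mem_Xp⟩
    change weakDiv (P.cell i) (P.flux p (u - w)) =
      weakDiv (P.cell i) (P.flux p u) - weakDiv (P.cell i) (P.flux p w) at this
    rw [this, (h.isWeakDiv i).weakDiv_eq, sub_neg_eq_add]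
  rw [resNorm, hj, P.lpNorm_sq_eq_sum (P.divFlux_ae_eq p (u - w)),
    P.lpNorm_sq_eq_sum (f := fun x => P.divFlux p u x + ℓ x)
      (F := fun i => weakDiv (P.cell i) (P.flux p (u - w)))]
  intro i
  rw [hd i]
  filter_upwards [P.divFlux_ae_eq p u i, P.coeFn_restrictCell ℓ i,
    Lp.coeFn_add (weakDiv (P.cell i) (P.flux p u)) (P.restrictCell ℓ i)] with x h1 h2 h3
  rw [h3, Pi.add_apply, h2, h1]

end BoxPartition

end

end Transmission

/-! ### The main theorem -/

theorem mainTheorem1 {d : ℕ} (hd : 0 < d) (a b : Fin d → ℝ) (hab : ∀ k, a k < b k)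
    (Γ : Set (Transmission.Space d)) (Θ : ℝ) (hΘ : 0 < Θ) :
    ∃ C : ℝ, 0 < C ∧
      ∀ P : Transmission.BoxPartition a b, P.interface = Γ →
      ∀ p : Fin P.card → ℝ, (∀ i, 0 < p i) →
        -- the residuals control the `H¹₀` norm on `𝕏ᵖ`
        (∀ u ∈ P.Xp p, P.normH10 u ≤ C / (⨅ i, p i) *
          √((lpNorm (P.divFlux p u) 2
              (volume.restrict (Transmission.openBox a b : Set (Transmission.Space d)))) ^ 2
            + Θ * ‖P.jumpFlux p u‖ ^ 2)) ∧
        -- the residual norm is a norm on `𝕏ᵖ`, equivalent to the graph norm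
        Transmission.IsNorm (fun u : P.Xp p => P.resNorm p Θ u) ∧
        Transmission.IsNorm (fun u : P.Xp p => P.graphNorm p u) ∧
        (∃ c₁ c₂ : ℝ, 0 < c₁ ∧ 0 < c₂ ∧ ∀ u ∈ P.Xp p,
          c₁ * P.graphNorm p u ≤ P.resNorm p Θ u ∧ P.resNorm p Θ u ≤ c₂ * P.graphNorm p u) ∧
        -- error estimate for the transmission problem with source `ℓ` and weak solution `w`
        (∀ ℓ w : Transmission.L2 (Transmission.openBox a b), P.IsWeakSolution p ℓ w →
          w ∈ P.Xp p ∧ ∀ u ∈ P.Xp p,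
            P.normH10 (u - w) ≤ C / (⨅ i, p i) * P.resNorm p Θ (u - w) ∧
            P.resNorm p Θ (u - w) =
              √((lpNorm (fun x => P.divFlux p u x + ℓ x) 2
                  (volume.restrict (Transmission.openBox a b : Set (Transmission.Space d)))) ^ 2
                + Θ * ‖P.jumpFlux p u‖ ^ 2)) := by
  obtain ⟨C, hC, hest⟩ := Transmission.BoxPartition.exists_normH10_le hd hab Γ hΘ
  refine ⟨C, hC, fun P hP p hp => ?_⟩
  have hest := hest P hP p hp
  -- Definiteness of both norms reduces to a vanishing gradient: the residual estimate provides it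
  -- for the residual norm, and the graph norm contains the gradient.
  have hzero : ∀ u : P.Xp p, P.normH10 u = 0 → u = 0 := fun u hu =>
    Subtype.ext (Transmission.eq_zero_of_weakGrad_eq_zero hd u.2.1 (norm_eq_zero.1 hu))
  refine ⟨hest, ?_, ?_, Transmission.BoxPartition.exists_graphNorm_equiv_resNorm hΘ hest, fun ℓ w hw =>
    ⟨hw.mem_Xp, fun u hu => ⟨hest _ (Submodule.sub_mem _ hu hw.mem_Xp),
      hw.resNorm_sub hu Θ⟩⟩⟩
  · simp_rw [Transmission.BoxPartition.resNorm_eq_norm hΘ.le]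
    refine Transmission.isNorm_norm_comp _ fun u hu => hzero u ?_
    have := hest u u.2
    rw [Transmission.BoxPartition.resNorm_eq_norm hΘ.le, hu, mul_zero] at this
    exact le_antisymm this (norm_nonneg _)
  · simp_rw [Transmission.BoxPartition.graphNorm_eq_norm]
    refine Transmission.isNorm_norm_comp _ fun u hu => hzero u ?_
    have h := Transmission.BoxPartition.graphNorm_sq (p := p) (u : Transmission.L2 _)
    rw [Transmission.BoxPartition.graphNorm_eq_norm, hu] at h
    have h1 : P.normH10 u ^ 2 ≤ 0 := by
      rw [show (0 : ℝ) = 0 ^ 2 by norm_num, h, add_assoc]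
      exact le_add_of_nonneg_right (by positivity)
    exact pow_eq_zero_iff two_ne_zero |>.1 (le_antisymm h1 (sq_nonneg _))
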